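/- Let $K$ be a field of arbitrary characteristic. All algebras are finite-dimensional $K$-algebras. An algebra $A$ is *symmetric* if it has a linear form $\varphi$ with $\varphi(xy)=\varphi(yx)$ such that $(x,y)\mapsto\varphi(xy)$ is non-degenerate; it is *indecomposable* if $A\neq 0$ and $0,1$ are its only central idempotents; it is *basic* if $A/\operatorname{rad}A\cong K\times\cdots\times K$ (over an algebraically closed field, the usual notion). The *Cartan matrix* of a basic algebra with complete set $e_1,\dots,e_n$ of primitive orthogonal idempotents is $(\dim_K e_iAe_j)_{i,j}$. Write $Z(A)$ for the centre and $R(A)=Z(A)\cap\operatorname{soc}(A)$ for the Reynolds ideal. Two algebras $A,B$ are *stably equivalent of Morita type* if there are finite-dimensional bimodules ${}_AM_B$ and ${}_BN_A$ (with $K$ acting centrally), projective as left and as right modules, such that $M\otimes_BN\cong A\oplus P$ and $N\otimes_AM\cong B\oplus Q$ as bimodules, with $P$ a projective $A$-$A$-bimodule and $Q$ a projective $B$-$B$-bimodule. Consider the following classes of basic indecomposable symmetric $K$-algebras; in each of them, $R$ is described through the given isomorphism for $Z$. * For $\ell\ge 2$, an algebra $A$ is of type $A_1^{\ell}$ if $\dim_KA=4\ell$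 and: if $\operatorname{char}K=2$, then $Z(A)\cong K[U,T,V,W]/(U^\ell,T^2,V^2,W^2,UT,UV,UW,TV,TW,VW)$ with $R(A)=KT$; if $\operatorname{char}K\ne2$, then $Z(A)\cong K[U,V,W]/(U^{\ell+1},V^2,W^2,UV,UW,VW)$ with $R(A)=KU^\ell$. * For $k,s\ge1$, an algebra $A$ is of type $A_2^{k,s}$ if its Cartan matrix is, for some numbering of the idempotents, $\begin{pmatrix}4k&2k\\2k&s+k\end{pmatrix}$ and: if $\operatorname{char}K=2$, then $Z(A)\cong K[u,v,w,t]/(u^k-v^s,w^2,t^2,uv,uw,vw,tw,ut,vt)$ with $R(A)=Ku^k\oplus Kw$; if $\operatorname{char}K\neq2$, then $Z(A)\cong K[u,v,t]/(u^{k+1},v^{s+1},t^2,uv,ut,vt)$ with $R(A)=Ku^k\oplus Kv^s$. * For $a,b,c\ge1$, an algebra $A$ is of type $A_3^{a,b,c}$ if its Cartan matrix is, for some numbering of the idempotents, $\begin{pmatrix}a+b&a&b\\a&a+c&c\\b&c&b+c\end{pmatrix}$ and $Z(A)$ is isomorphic to the quotient of $K[A,B,C,S_1,S_2,S_3]$ by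 the ideal generated by $A^{a+1}$, $B^{b+1}$, $C^{c+1}$, $A^a-S_2-S_3$, $B^b-S_3-S_1$, $C^c-S_1-S_2$, $AS_i$, $BS_i$, $CS_i$, $S_iS_j$ $(i,j\in\{1,2,3\})$, $AB$, $AC$, $BC$, with $R(A)=KS_1\oplus KS_2\oplus KS_3$. Then, for all parameters $a,b,c,k,s\ge1$ and $\ell\ge2$: 1. no algebra of type $A_3^{a,b,c}$ is stably equivalent of Morita type to an algebra of type $A_2^{k,s}$; 2. no algebra of type $A_2^{k,s}$ is stably equivalent of Morita type to an algebra of type $A_1^{\ell}$; 3. no algebra of type $A_3^{a,b,c}$ is stably equivalent of Morita type to an algebra of type $A_1^{\ell}$. -/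

import Mathlib

universe u v w

open scoped TensorProduct

namespace StableMorita

/-! ### Finite-dimensional algebras -/

section Algebras

variable (K : Type u) [Field K] (A : Type v) [Ring A] [Algebra K A]

/-- `A` is a symmetric `K`-algebra: it is finite-dimensional and carries a symmetrizing form, that
is, a linear form `φ` with `φ (a b) = φ (b a)` for which `(a, b) ↦ φ (a b)` is non-degenerate. -/
def IsSymmetricAlgebra : Prop :=
  FiniteDimensional K A ∧
    ∃ φ : A →ₗ[K] K, (∀ a b : A, φ (a * b) = φ (b * a)) ∧ ∀ a : A, (∀ b : A, φ (a * b) = 0) → a = 0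

/-- `A` is indecomposable as a ring: it is non-zero and its only central idempotents are
`0` and `1`. -/
def IsIndecomposable : Prop :=
  Nontrivial A ∧ ∀ e : A, IsIdempotentElem e → e ∈ Subring.center A → e = 0 ∨ e = 1

/-- `A` is a (split) basic `K`-algebra: `A / rad A` is isomorphic to `K × ⋯ × K`. Over an
algebraically closed field this is equivalent to `A / rad A` being a product of division rings. -/
def IsBasic : Prop :=
  ∃ n : ℕ, Nonempty ((A ⧸ Ring.jacobson A) ≃ₐ[K] (Fin n → K))

variable {A} in
/-- A primitive idempotent: a non-zero idempotent that is not the sum of two non-zero orthogonal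
idempotents. -/
def IsPrimitiveIdempotent (e : A) : Prop :=
  IsIdempotentElem e ∧ e ≠ 0 ∧
    ∀ f g : A, IsIdempotentElem f → IsIdempotentElem g → f * g = 0 → g * f = 0 → f + g = e →
      f = 0 ∨ g = 0

variable {A} in
/-- The subspace `e A f` of `A`. -/
def peirce (e f : A) : Submodule K A :=
  LinearMap.range (LinearMap.mulLeft K e ∘ₗ LinearMap.mulRight K f)

/-- `C` is the Cartan matrix of the basic algebra `A`, for some numbering of the simple modules:
for a complete set `e` of primitive orthogonal idempotents, `C i j = dim (e i A e j)`. -/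
def HasCartanMatrix {n : ℕ} (C : Matrix (Fin n) (Fin n) ℕ) : Prop :=
  ∃ e : Fin n → A, CompleteOrthogonalIdempotents e ∧ (∀ i, IsPrimitiveIdempotent (e i)) ∧
    ∀ i j, Module.finrank K (peirce K (e i) (e j)) = C i j

/-- The socle of `A`: the sum of the minimal left ideals. -/
def socle : Submodule A A :=
  sSup {S : Submodule A A | IsSimpleModule A S}

/-- The Reynolds ideal `R(A) = Z(A) ∩ soc(A)`. -/
def reynoldsIdeal : Submodule K A :=
  Subalgebra.toSubmodule (Subalgebra.center K A) ⊓ (socle A).restrictScalars K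

/-- There is an isomorphism of `K`-algebras `K[Xᵢ] / (rels) ≃ Z(A)` under which the Reynolds ideal
is the `K`-linear span of the classes of the elements of `gens`. -/
def HasCentreAndReynolds {σ : Type} (rels gens : Set (MvPolynomial σ K)) : Prop :=
  ∃ φ : (MvPolynomial σ K ⧸ Ideal.span rels) ≃ₐ[K] Subalgebra.center K A,
    reynoldsIdeal K A =
      Submodule.span K ((fun f => (φ (Ideal.Quotient.mk (Ideal.span rels) f) : A)) '' gens)

end Algebras

/-! ### Stable equivalences of Morita type -/

/-- An `A`-`B`-bimodule on which `K` acts centrally; the right action of `B` is a left action of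
`Bᵐᵒᵖ`. Finite-dimensional bimodules can always be realized in the universe of `K`. -/
structure Bimodule (K : Type u) [Field K] (A : Type v) [Ring A] [Algebra K A]
    (B : Type w) [Ring B] [Algebra K B] where
  /-- The underlying type. -/
  carrier : Type u
  [addCommGroup : AddCommGroup carrier]
  [module : Module K carrier]
  [leftModule : Module A carrier]
  [rightModule : Module Bᵐᵒᵖ carrier]
  [leftTower : IsScalarTower K A carrier]
  [rightTower : IsScalarTower K Bᵐᵒᵖ carrier]
  [comm : SMulCommClass A Bᵐᵒᵖ carrier]

attribute [instance] Bimodule.addCommGroup Bimodule.module Bimodule.leftModule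
  Bimodule.rightModule Bimodule.leftTower Bimodule.rightTower Bimodule.comm

section Bimodules

variable {K : Type u} [Field K] {A : Type v} [Ring A] [Algebra K A]
  {B : Type w} [Ring B] [Algebra K B]

/-- The kernel of `M ⊗[K] N → M ⊗[B] N`, spanned by the elements `(m b) ⊗ n - m ⊗ (b n)`. -/
def balancingSubmodule (M : Bimodule K A B) (N : Bimodule K B A) :
    Submodule K (M.carrier ⊗[K] N.carrier) :=
  Submodule.span K {x | ∃ (m : M.carrier) (b : B) (n : N.carrier),
    x = (MulOpposite.op b • m) ⊗ₜ[K] n - m ⊗ₜ[K] (b • n)}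

/-- The tensor product `M ⊗[B] N` of an `A`-`B`-bimodule and a `B`-`A`-bimodule. -/
abbrev BalancedTensor (M : Bimodule K A B) (N : Bimodule K B A) : Type u :=
  (M.carrier ⊗[K] N.carrier) ⧸ balancingSubmodule M N

/-- The class of `m ⊗ n` in `M ⊗[B] N`. -/
def balancedTmul (M : Bimodule K A B) (N : Bimodule K B A) (m : M.carrier) (n : N.carrier) :
    BalancedTensor M N :=
  (balancingSubmodule M N).mkQ (m ⊗ₜ[K] n)

/-- `M ⊗[B] N` is isomorphic to `A ⊕ P` as an `A`-`A`-bimodule. The actions on `M ⊗[B] N` are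
`a (m ⊗ n) = (a m) ⊗ n` and `(m ⊗ n) a = m ⊗ (n a)`; as the elements `m ⊗ n` span `M ⊗[B] N`,
a linear isomorphism is an isomorphism of bimodules as soon as it respects the actions on them. -/
def TensorIsoRegularSum (M : Bimodule K A B) (N : Bimodule K B A) (P : Bimodule K A A) : Prop :=
  ∃ Φ : BalancedTensor M N ≃ₗ[K] A × P.carrier,
    (∀ (a : A) (m : M.carrier) (n : N.carrier),
      Φ (balancedTmul M N (a • m) n) = a • Φ (balancedTmul M N m n)) ∧
    ∀ (a : A) (m : M.carrier) (n : N.carrier),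
      Φ (balancedTmul M N m (MulOpposite.op a • n)) = MulOpposite.op a • Φ (balancedTmul M N m n)

attribute [local instance] TensorProduct.Algebra.module in
/-- `P` is projective as an `A`-`A`-bimodule, that is, as a module over `A ⊗[K] Aᵐᵒᵖ`. -/
def IsProjectiveBimodule (P : Bimodule K A A) : Prop :=
  Module.Projective (A ⊗[K] Aᵐᵒᵖ) P.carrier

variable (K A B) in
/-- `A` and `B` are stably equivalent of Morita type: there are finite-dimensional bimodules
`M` (over `A`-`B`) and `N` (over `B`-`A`), projective as left and as right modules, and projective
bimodules `P` and `Q` with `M ⊗[B] N ≃ A ⊕ P` and `N ⊗[A] M ≃ B ⊕ Q` as bimodules. -/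
def StablyEquivalentOfMoritaType : Prop :=
  ∃ (M : Bimodule K A B) (N : Bimodule K B A) (P : Bimodule K A A) (Q : Bimodule K B B),
    FiniteDimensional K M.carrier ∧ FiniteDimensional K N.carrier ∧
    Module.Projective A M.carrier ∧ Module.Projective Bᵐᵒᵖ M.carrier ∧
    Module.Projective B N.carrier ∧ Module.Projective Aᵐᵒᵖ N.carrier ∧
    IsProjectiveBimodule P ∧ IsProjectiveBimodule Q ∧
    TensorIsoRegularSum M N P ∧ TensorIsoRegularSum N M Q

end Bimodules

/-! ### The three classes of algebras -/

section Classes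

open MvPolynomial

variable (K : Type u) [Field K]

/-- The relations of `K[U, T, V, W]` in characteristic `2` for the one-simple class. -/
def oneRelsCharTwo (l : ℕ) : Set (MvPolynomial (Fin 4) K) :=
  let U := X 0; let T := X 1; let V := X 2; let W := X 3
  {U ^ l, T ^ 2, V ^ 2, W ^ 2, U * T, U * V, U * W, T * V, T * W, V * W}

/-- The relations of `K[U, V, W]` in characteristic different from `2` for the one-simple class. -/
def oneRels (l : ℕ) : Set (MvPolynomial (Fin 3) K) :=
  let U := X 0; let V := X 1; let W := X 2
  {U ^ (l + 1), V ^ 2, W ^ 2, U * V, U * W, V * W}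

/-- The relations of `K[u, v, w, t]` in characteristic `2` for the two-simples class. -/
def twoRelsCharTwo (k s : ℕ) : Set (MvPolynomial (Fin 4) K) :=
  let u := X 0; let v := X 1; let w := X 2; let t := X 3
  {u ^ k - v ^ s, w ^ 2, t ^ 2, u * v, u * w, v * w, t * w, u * t, v * t}

/-- The relations of `K[u, v, t]` in characteristic different from `2` for the two-simples class. -/
def twoRels (k s : ℕ) : Set (MvPolynomial (Fin 3) K) :=
  let u := X 0; let v := X 1; let t := X 2
  {u ^ (k + 1), v ^ (s + 1), t ^ 2, u * v, u * t, v * t}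

/-- The relations of `K[A, B, C, S₁, S₂, S₃]` for the three-simples class. -/
def threeRels (a b c : ℕ) : Set (MvPolynomial (Fin 6) K) :=
  let A := X 0; let B := X 1; let C := X 2; let S₁ := X 3; let S₂ := X 4; let S₃ := X 5
  {A ^ (a + 1), B ^ (b + 1), C ^ (c + 1), A ^ a - S₂ - S₃, B ^ b - S₃ - S₁, C ^ c - S₁ - S₂,
    A * S₁, A * S₂, A * S₃, B * S₁, B * S₂, B * S₃, C * S₁, C * S₂, C * S₃,
    S₁ * S₁, S₁ * S₂, S₁ * S₃, S₂ * S₂, S₂ * S₃, S₃ * S₃, A * B, A * C, B * C}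

variable (R : Type v) [Ring R] [Algebra K R]

/-- `R` is an algebra of type `A₁^l`. -/
structure IsTypeOne (l : ℕ) : Prop where
  symmetric : IsSymmetricAlgebra K R
  indecomposable : IsIndecomposable R
  basic : IsBasic K R
  finrank_eq : Module.finrank K R = 4 * l
  centre_of_char_two : CharP K 2 → HasCentreAndReynolds K R (oneRelsCharTwo K l) {X 1}
  centre_of_char_ne_two : ¬ CharP K 2 → HasCentreAndReynolds K R (oneRels K l) {X 0 ^ l}

/-- `R` is an algebra of type `A₂^{k,s}`. -/
structure IsTypeTwo (k s : ℕ) : Prop where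
  symmetric : IsSymmetricAlgebra K R
  indecomposable : IsIndecomposable R
  basic : IsBasic K R
  cartan : HasCartanMatrix K R !![4 * k, 2 * k; 2 * k, s + k]
  centre_of_char_two : CharP K 2 → HasCentreAndReynolds K R (twoRelsCharTwo K k s) {X 0 ^ k, X 2}
  centre_of_char_ne_two :
    ¬ CharP K 2 → HasCentreAndReynolds K R (twoRels K k s) {X 0 ^ k, X 1 ^ s}

/-- `R` is an algebra of type `A₃^{a,b,c}`. In characteristic different from `2` the span of
`S₁, S₂, S₃` is also the span of `A ^ a, B ^ b, C ^ c`. -/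
structure IsTypeThree (a b c : ℕ) : Prop where
  symmetric : IsSymmetricAlgebra K R
  indecomposable : IsIndecomposable R
  basic : IsBasic K R
  cartan : HasCartanMatrix K R !![a + b, a, b; a, a + c, c; b, c, b + c]
  centre : HasCentreAndReynolds K R (threeRels K a b c) {X 3, X 4, X 5}

end Classes

end StableMorita

/-! Two invariants of stable equivalence of Morita type contradict each other.

The first is the centre modulo the Reynolds ideal. For the three classes Z/R is K[x₀,x₁,x₂]/(xᵢ^pᵢ,
xᵢxⱼ) with p = (a,b,c), (k,s,2), (l,2,2), in every characteristic. The dimensions of the powers of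
its nilradical determine p up to order, hence the product p₀p₁p₂: abc, 2ks, 4l.

The second is the Cartan determinant, which is 4abc, 4ks, 4l. If non-zero, the determinant of one
algebra divides that of the other. Equality of the products makes the first determinant 2, 2 or 4
times the second one, which is positive, so it cannot divide it.

Divisibility of determinants (`det_cartan_dvd`): with C, D the Cartan matrices, counting dim eᵢMfⱼ
from both sides gives m D = C m'; counting the corners of M ⊗ N ≅ A ⊕ P gives m q C = (1 + C p) C,
because the tops of a projective bimodule contribute multiples of C. The matrix lemma `det_dvd_det`
concludes.

Invariance of Z/R (`nonempty_algEquiv`): Hattori–Stallings traces turn M and N into transfers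
between A/[A,A] and B/[B,B]. On the images of the radicals these are mutually inverse, since a
projective bimodule contributes traces of nilpotent maps. Conjugation by the transfers carries the
operators given by Z(A) to those given by Z(B), and for a symmetric algebra the centre acts on the
image of the radical with kernel exactly R (`mem_ker_centerAction_iff`). -/

namespace StableMorita

/-! ### Projective modules over split basic algebras -/

section SplitBasic

/-- A complete set of orthogonal idempotents `e i`, together with the characters `π i` dual to
them, whose common kernel is a nil ideal. -/
structure SplitIdempotents (K : Type u) [Field K] (R : Type v) [Ring R] [Algebra K R] (n : ℕ) where
  /-- The idempotents. -/
  e : Fin n → R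
  complete : CompleteOrthogonalIdempotents e
  /-- The characters. -/
  π : Fin n → R →ₐ[K] K
  π_e : ∀ i j, π i (e j) = if i = j then 1 else 0
  nil : ∀ a, (∀ i, π i a = 0) → IsNilpotent a

variable {K : Type u} [Field K] {R : Type v} [Ring R] [Algebra K R] {n : ℕ}

namespace SplitIdempotents

variable (S : SplitIdempotents K R n)

theorem mem_jacobson {a : R} (ha : ∀ i, S.π i a = 0) : a ∈ Ring.jacobson R := by
  rw [← Ideal.jacobson_bot, Ideal.mem_jacobson_iff]
  intro y
  have hn : IsNilpotent (y * a) := S.nil _ fun i => by simp [ha i]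
  obtain ⟨u, hu⟩ := hn.isUnit_one_add
  refine ⟨↑u⁻¹, ?_⟩
  have : (↑u⁻¹ : R) * (1 + y * a) = 1 := by rw [← hu]; simp
  rw [Ideal.mem_bot, mul_assoc, ← this]
  noncomm_ring

/-- The idempotents and characters of the opposite algebra. -/
def op : SplitIdempotents K Rᵐᵒᵖ n where
  e i := MulOpposite.op (S.e i)
  complete :=
    { idem := fun i => by
        rw [IsIdempotentElem, ← MulOpposite.op_mul, (S.complete.idem i).eq]
      ortho := fun i j hij => by
        change MulOpposite.op (S.e i) * MulOpposite.op (S.e j) = 0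
        rw [← MulOpposite.op_mul, S.complete.ortho hij.symm, MulOpposite.op_zero]
      complete := by
        rw [← MulOpposite.op_one, ← S.complete.complete]
        exact (map_sum MulOpposite.opAddEquiv _ _).symm }
  π i := (S.π i).fromOpposite fun _ _ => Commute.all _ _
  π_e i j := S.π_e i j
  nil a ha := by
    obtain ⟨N, hN⟩ := S.nil a.unop ha
    exact ⟨N, MulOpposite.unop_injective (by simpa using hN)⟩

end SplitIdempotents

/-- The `L`-submodule generated by `(ker χ) V`. -/
def kerSpan (L : Type*) {V : Type*} [Semiring L] [AddCommGroup V] [Module L V] [Module R V]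
    (χ : R →ₐ[K] K) : Submodule L V :=
  Submodule.span L {y | ∃ (x : R) (v : V), χ x = 0 ∧ y = x • v}

variable {V : Type w} [AddCommGroup V] [Module K V] [Module R V] [IsScalarTower K R V]

theorem mkQ_smul (χ : R →ₐ[K] K) (x : R) (v : V) :
    (kerSpan (R := R) K χ).mkQ (x • v) = χ x • (kerSpan (R := R) (V := V) K χ).mkQ v := by
  rw [← map_smul, ← sub_eq_zero, ← map_sub, Submodule.mkQ_apply, Submodule.Quotient.mk_eq_zero]
  refine Submodule.subset_span ⟨x - algebraMap K R (χ x), v, by simp, ?_⟩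
  rw [sub_smul, algebraMap_smul]

/-- The dimension of the image of `W` in `V / (ker χ) V`. -/
noncomputable def multiplicity (χ : R →ₐ[K] K) (W : Submodule K V) : ℕ :=
  Module.finrank K (W.map (kerSpan (R := R) (V := V) K χ).mkQ)

/-- Used with `χ = π i`, `e = e i` and `I` the radical: if `π i x = 0`, then every character kills
`e i * x`. So the kernel of the projection to the i-th top becomes negligible modulo the radical
after multiplication by `e i`, as Nakayama's lemma requires. -/
theorem map_mem_smul_of_mem_kerSpan (χ : R →ₐ[K] K) (I : Ideal R) (e : R)
    (he : ∀ x, χ x = 0 → e * x ∈ I) (ε : V →ₗ[R] V) {y : V} (hy : y ∈ kerSpan (R := R) K χ) :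
    e • ε y ∈ I • LinearMap.range ε := by
  induction hy using Submodule.span_induction with
  | mem y hy =>
    obtain ⟨x, v, hx, rfl⟩ := hy
    rw [map_smul, smul_smul]
    exact Submodule.smul_mem_smul (he x hx) ⟨v, rfl⟩
  | zero => simp
  | add y z _ _ hy hz => rw [map_add, smul_add]; exact add_mem hy hz
  | smul c y _ hy =>
    have : e • ε (c • y) = (algebraMap K R c) • (e • ε y) := by
      rw [← algebraMap_smul R c y, map_smul, smul_smul, smul_smul, Algebra.commutes]
    rw [this]
    exact Submodule.smul_mem _ _ hy

/-- Idempotency shows that the left ideal L generated by the entries satisfies L ≤ JL, so Nakayama's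
lemma gives L = 0. -/
theorem eq_zero_of_idempotent_matrix {T : Type*} [Fintype T] (h : T → T → R)
    (hJ : ∀ s t, h s t ∈ Ring.jacobson R) (hh : ∀ s u, ∑ t, h s t * h t u = h s u) (s t : T) :
    h s t = 0 := by
  classical
  set L : Submodule R R := Submodule.span R (Set.range fun p : T × T => h p.1 p.2)
  have hL : L = ⊥ := by
    refine Submodule.FG.eq_bot_of_le_jacobson_smul
      (Submodule.fg_span (Set.finite_range _)) (Submodule.span_le.mpr ?_)
    rintro _ ⟨⟨s, u⟩, rfl⟩
    change h s u ∈ _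
    rw [← hh]
    exact Submodule.sum_mem _ fun t _ => Submodule.smul_mem_smul (hJ s t)
      (Submodule.subset_span ⟨(t, u), rfl⟩)
  have : h s t ∈ L := Submodule.subset_span ⟨(s, t), rfl⟩
  simpa [hL] using this

/-- The direct summand `ε V` of the projective module `V` is a direct sum of modules `R e i`, with
multiplicities read off from the top of `V`. -/
theorem SplitIdempotents.exists_basis (S : SplitIdempotents K R n) [FiniteDimensional K V]
    [Module.Projective R V] (ε : V →ₗ[R] V) (hε : ∀ x, ε (ε x) = ε x) :
    ∃ (v : (Σ i : Fin n, Fin (multiplicity (S.π i) ((LinearMap.range ε).restrictScalars K))) → V)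
      (g : (Σ i : Fin n, Fin (multiplicity (S.π i) ((LinearMap.range ε).restrictScalars K))) →
        V →ₗ[R] R),
      (∀ t, S.e t.1 • v t = v t) ∧ (∀ t, ε (v t) = v t) ∧ (∀ t x, g t x * S.e t.1 = g t x) ∧
      (∀ s t, g t (v s) = if s = t then S.e t.1 else 0) ∧ ∀ x, ∑ t, g t x • v t = ε x := by
  classical
  set Q := fun i => (kerSpan (R := R) (V := V) K (S.π i)).mkQ with hQ
  set d := fun i => multiplicity (S.π i) ((LinearMap.range ε).restrictScalars K) with hd
  let b : ∀ i, Module.Basis (Fin (d i)) K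
    (((LinearMap.range ε).restrictScalars K).map (Q i)) := fun i => Module.finBasis K _
  have hw : ∀ t : Σ i, Fin (d i), ∃ w, ε w = w ∧ Q t.1 w = b t.1 t.2 := by
    intro t
    obtain ⟨w, ⟨y, rfl⟩, hw⟩ := (b t.1 t.2).2
    exact ⟨ε y, hε y, hw⟩
  choose w hw1 hw2 using hw
  have idem : ∀ i, S.e i * S.e i = S.e i := fun i => (S.complete.idem i).eq
  -- Multiplication by the idempotent keeps the image in its own top and kills the image in all the
  -- other tops.
  let v : (Σ i, Fin (d i)) → V := fun t => S.e t.1 • w t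
  have hev : ∀ t, S.e t.1 • v t = v t := fun t => by simp only [v, smul_smul, idem]
  have hεv : ∀ t, ε (v t) = v t := fun t => by simp only [v, map_smul, hw1]
  have hQv : ∀ t, Q t.1 (v t) = b t.1 t.2 := fun t => by
    simp only [v, hQ, mkQ_smul, S.π_e, if_true, one_smul]; exact hw2 t
  have hQv' : ∀ i t, i ≠ t.1 → Q i (v t) = 0 := fun i t h => by
    simp only [v, hQ, mkQ_smul, S.π_e, if_neg h, zero_smul]
  set W : Submodule R V := Submodule.span R (Set.range v) with hW
  -- Nakayama: lifts of bases of all the tops generate the summand.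
  have hspan : LinearMap.range ε ≤ W := by
    have key : LinearMap.range ε ≤ W ⊔ Ring.jacobson R • LinearMap.range ε := by
      rintro _ ⟨y, rfl⟩
      rw [← one_smul R (ε y), ← S.complete.complete, Finset.sum_smul]
      refine Submodule.sum_mem _ fun i _ => ?_
      have hmem : Q i (ε y) ∈ ((LinearMap.range ε).restrictScalars K).map (Q i) :=
        ⟨ε y, ⟨y, rfl⟩, rfl⟩
      set c := (b i).repr ⟨_, hmem⟩ with hc
      have h1 : Q i (ε y - ∑ t, c t • w ⟨i, t⟩) = 0 := by
        have := congrArg Subtype.val ((b i).sum_repr ⟨_, hmem⟩)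
        simp only [AddSubmonoidClass.coe_finsetSum, Submodule.coe_smul] at this
        rw [map_sub, ← this, map_sum, sub_eq_zero]
        exact Finset.sum_congr rfl fun t _ => by rw [map_smul, hw2 ⟨i, t⟩]
      rw [hQ, Submodule.mkQ_apply, Submodule.Quotient.mk_eq_zero] at h1
      have h2 := map_mem_smul_of_mem_kerSpan (S.π i) (Ring.jacobson R) (S.e i)
        (fun x hx => S.mem_jacobson fun j => by
          rw [map_mul, S.π_e]
          split_ifs with h
          · rw [h, hx, mul_zero]
          · rw [zero_mul]) ε h1
      have h3 : S.e i • ε y = (∑ t, c t • v ⟨i, t⟩) +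
          S.e i • ε (ε y - ∑ t, c t • w ⟨i, t⟩) := by
        have : S.e i • ε (∑ t, c t • w ⟨i, t⟩) = ∑ t, c t • v ⟨i, t⟩ := by
          rw [map_sum, Finset.smul_sum]
          refine Finset.sum_congr rfl fun t _ => ?_
          rw [← algebraMap_smul R (c t), map_smul, hw1, smul_smul, ← Algebra.commutes,
            ← smul_smul, algebraMap_smul]
        rw [map_sub, smul_sub, hε, this]
        abel
      rw [h3]
      refine add_mem (Submodule.mem_sup_left (Submodule.sum_mem _ fun t _ => ?_))
        (Submodule.mem_sup_right h2)
      rw [← algebraMap_smul R (c t)]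
      exact Submodule.smul_mem _ _ (Submodule.subset_span ⟨_, rfl⟩)
    have fin : Module.Finite R V := Module.Finite.of_restrictScalars_finite K R V
    have : (LinearMap.range ε).map W.mkQ = ⊥ := by
      refine Submodule.FG.eq_bot_of_le_jacobson_smul ?_ ?_
      · rw [LinearMap.range_eq_map, ← Submodule.map_comp]
        exact fin.fg_top.map _
      · refine (Submodule.map_mono key).trans ?_
        rw [Submodule.map_sup, Submodule.map_smul'']
        simp [Submodule.mkQ_map_self]
    rwa [eq_bot_iff, Submodule.map_le_iff_le_comap, ← LinearMap.ker, Submodule.ker_mkQ] at this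
  let Ψ : ((Σ i, Fin (d i)) → R) →ₗ[R] LinearMap.range ε :=
    LinearMap.codRestrict _ (Fintype.linearCombination R v) (fun r => by
      rw [Fintype.linearCombination_apply]
      exact Submodule.sum_mem _ fun t _ => Submodule.smul_mem _ _ ⟨v t, hεv t⟩)
  have hΨ : ∀ r, (Ψ r : V) = ∑ t, r t • v t := fun r => by
    simp [Ψ, Fintype.linearCombination_apply]
  have hsurj : Function.Surjective Ψ := by
    rintro ⟨y, hy⟩
    obtain ⟨r, hr⟩ := (Submodule.mem_span_range_iff_exists_fun R).mp (hspan hy)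
    exact ⟨r, Subtype.ext (by rw [hΨ, hr])⟩
  -- Projectivity of `V` lifts `ε` to coordinates in a free module; cutting the t-th coordinate down
  -- to `R e t` gives `g`.
  obtain ⟨s, hs⟩ := Module.projective_lifting_property Ψ ε.rangeRestrict hsurj
  have hs' : ∀ x, ∑ t, s x t • v t = ε x := fun x => by
    rw [← hΨ]; exact congrArg Subtype.val (LinearMap.congr_fun hs x)
  let g : (Σ i, Fin (d i)) → V →ₗ[R] R := fun t =>
    (LinearMap.toSpanSingleton R R (S.e t.1)) ∘ₗ (LinearMap.proj t) ∘ₗ s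
  have hg : ∀ t x, g t x = s x t * S.e t.1 := fun t x => by simp [g]
  have hge : ∀ t x, g t x * S.e t.1 = g t x := fun t x => by rw [hg, mul_assoc, idem]
  have hgsum : ∀ x, ∑ t, g t x • v t = ε x := fun x => by
    rw [← hs']
    exact Finset.sum_congr rfl fun t _ => by rw [hg, mul_smul, hev]
  have heg : ∀ s t, S.e s.1 * g t (v s) = g t (v s) := fun s t => by
    rw [← smul_eq_mul, ← map_smul, hev]
  have hgg : ∀ s u, ∑ t, g t (v s) * g u (v t) = g u (v s) := fun s u => by
    conv_rhs => rw [← hεv s, ← hgsum, map_sum]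
    simp
  refine ⟨v, g, hev, hεv, hge, fun s t => ?_, hgsum⟩
  -- `E` is a two-sided unit for the idempotent matrix `g t (v s)`, so their difference is again
  -- idempotent. Its entries lie in the radical because both matrices act as the identity on the
  -- chosen bases of the tops; hence it vanishes.
  let E : (Σ i, Fin (d i)) → (Σ i, Fin (d i)) → R := fun s t => if s = t then S.e t.1 else 0
  have hE1 : ∀ s u, ∑ t, E s t * E t u = E s u := fun s u => by
    simp only [E, ite_mul, zero_mul, Finset.sum_ite_eq, Finset.mem_univ, if_true]
    split_ifs with h
    · rw [h, idem]
    · simp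
  have hE2 : ∀ s u, ∑ t, E s t * g u (v t) = g u (v s) := fun s u => by
    simp [E, heg]
  have hE3 : ∀ s u, ∑ t, g t (v s) * E t u = g u (v s) := fun s u => by
    simp [E, hge]
  have h0 := eq_zero_of_idempotent_matrix (fun s t => E s t - g t (v s)) ?_ ?_ s t
  · exact (sub_eq_zero.mp h0).symm
  · intro s t
    refine S.mem_jacobson fun j => ?_
    rw [← heg s t, ← hge t (v s)]
    by_cases hj : j = s.1
    · subst hj
      have hsum : Q s.1 (v s) = ∑ t, S.π s.1 (g t (v s)) • Q s.1 (v t) := by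
        conv_lhs => rw [← hεv s, ← hgsum, map_sum]
        exact Finset.sum_congr rfl fun t _ => mkQ_smul _ _ _
      rw [Fintype.sum_sigma, Finset.sum_eq_single s.1] at hsum
      rotate_left
      · intro i _ hi
        exact Finset.sum_eq_zero fun t _ => by rw [hQv' _ _ (Ne.symm hi), smul_zero]
      · simp
      obtain ⟨i, s⟩ := s
      obtain ⟨i', t⟩ := t
      simp only at hsum ⊢
      by_cases hi : i = i'
      · subst hi
        have hb : b i s = ∑ t, S.π i (g ⟨i, t⟩ (v ⟨i, s⟩)) • b i t := by
          apply Subtype.ext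
          simp only [AddSubmonoidClass.coe_finsetSum, Submodule.coe_smul]
          rw [← hQv ⟨i, s⟩]
          refine hsum.trans (Finset.sum_congr rfl fun t _ => ?_)
          rw [← hQv ⟨i, t⟩]
        have := congrArg (fun y => (b i).repr y t) hb
        simp only [Module.Basis.repr_self, map_sum, map_smul, Finsupp.coe_finsetSum,
          Finset.sum_apply, Finsupp.smul_apply, Finsupp.single_apply, smul_eq_mul, mul_ite,
          mul_one, mul_zero, Finset.sum_ite_eq', Finset.mem_univ, if_true] at this
        simp only [E, map_sub, map_mul, S.π_e, if_true, one_mul, mul_one, ← this]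
        by_cases hst : s = t
        · simp [hst, S.π_e]
        · simp [hst]
      · have : (⟨i, s⟩ : Σ i, Fin (d i)) ≠ ⟨i', t⟩ := fun h => hi (congrArg Sigma.fst h)
        simp [E, this, S.π_e, hi]
    · have hE : S.π j (E s t) = 0 := by
        simp only [E]
        split_ifs with h
        · rw [S.π_e, ← h, if_neg hj]
        · simp
      simp [hE, S.π_e, hj]
  · intro s u
    simp only [sub_mul, mul_sub, Finset.sum_sub_distrib, hE1, hE2, hE3, hgg]
    abel

theorem mem_peirce {e f x : R} (he : e * x = x) (hf : x * f = x) : x ∈ peirce K e f :=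
  ⟨x, by simp [hf, he]⟩

/-- The dimension of `e j ε V` in terms of the multiplicities. -/
theorem SplitIdempotents.finrank_range (S : SplitIdempotents K R n) [FiniteDimensional K R]
    [FiniteDimensional K V] [Module.Projective R V] (ε : V →ₗ[R] V) (hε : ∀ x, ε (ε x) = ε x)
    (j : Fin n) :
    Module.finrank K (LinearMap.range (Algebra.lsmul K K V (S.e j) ∘ₗ ε.restrictScalars K)) =
      ∑ i, Module.finrank K (peirce K (S.e j) (S.e i)) *
        multiplicity (S.π i) ((LinearMap.range ε).restrictScalars K) := by
  classical
  obtain ⟨v, g, hev, hεv, hge, hgv, hgsum⟩ := S.exists_basis ε hε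
  have hidem := (S.complete.idem j).eq
  have hfix : ∀ y ∈ LinearMap.range (Algebra.lsmul K K V (S.e j) ∘ₗ ε.restrictScalars K),
      S.e j • y = y ∧ ε y = y := by
    rintro _ ⟨x, rfl⟩
    simp [smul_smul, hidem, hε]
  -- The coordinates `g t` identify the `e j`-part of `ε V` with the direct sum of the Peirce spaces
  -- `e j R e t`.
  let F : LinearMap.range (Algebra.lsmul K K V (S.e j) ∘ₗ ε.restrictScalars K) →ₗ[K]
      (∀ t : Σ i, Fin (multiplicity (S.π i) ((LinearMap.range ε).restrictScalars K)),
        peirce K (S.e j) (S.e t.1)) :=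
    LinearMap.pi fun t => LinearMap.codRestrict _
      ((g t).restrictScalars K ∘ₗ Submodule.subtype _) (fun y => by
        refine mem_peirce ?_ (hge t _)
        change S.e j * g t y = g t y
        rw [← smul_eq_mul, ← map_smul, (hfix y y.2).1])
  have hF : ∀ y t, (F y t : R) = g t y := fun y t => rfl
  have hbij : Function.Bijective F := by
    constructor
    · rw [injective_iff_map_eq_zero]
      intro y hy
      apply Subtype.ext
      rw [← (hfix y y.2).2, ← hgsum]
      exact Finset.sum_eq_zero fun t _ => by rw [← hF, hy]; simp
    · intro r
      have hr : ∀ t, S.e j * (r t : R) = r t ∧ (r t : R) * S.e t.1 = r t := fun t => by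
        obtain ⟨x, hx⟩ := (r t).2
        rw [← hx]
        simp [mul_assoc, (S.complete.idem t.1).eq]
        simp [← mul_assoc, hidem]
      refine ⟨⟨∑ t, (r t : R) • v t, ⟨∑ t, (r t : R) • v t, ?_⟩⟩, ?_⟩
      · simp only [LinearMap.comp_apply, LinearMap.restrictScalars_apply, map_sum, map_smul, hεv,
          Algebra.lsmul_coe, smul_smul, (hr _).1]
      · funext t
        apply Subtype.ext
        rw [hF]
        simp [hgv, (hr t).2]
  rw [(LinearEquiv.ofBijective F hbij).finrank_eq, Module.finrank_pi_fintype,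
    Fintype.sum_sigma]
  refine Finset.sum_congr rfl fun i _ => ?_
  refine (Finset.sum_const (Module.finrank K (peirce K (S.e j) (S.e i)))).trans ?_
  rw [Finset.card_univ, Fintype.card_fin, smul_eq_mul, mul_comm]

end SplitBasic

/-! ### Dual bases -/

section DualBases

theorem projective_of_dualBasis {R : Type*} [Ring R] {V : Type*} [AddCommGroup V] [Module R V]
    {ι : Type*} [Fintype ι] (m : ι → V) (f : ι → V →ₗ[R] R) (h : ∀ x, ∑ i, f i x • m i = x) :
    Module.Projective R V := by
  classical
  refine Module.Projective.of_split (LinearMap.pi f) (Fintype.linearCombination R m) ?_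
  ext x
  simpa [Fintype.linearCombination_apply] using h x

theorem exists_dualBasis (R : Type*) [Ring R] (V : Type*) [AddCommGroup V] [Module R V]
    [Module.Finite R V] [Module.Projective R V] :
    ∃ (r : ℕ) (m : Fin r → V) (f : Fin r → V →ₗ[R] R), ∀ x, ∑ i, f i x • m i = x := by
  obtain ⟨r, f, g, -, -, h⟩ := Module.Finite.exists_comp_eq_id_of_projective R V
  refine ⟨r, fun i => f (Pi.single i 1), fun i => LinearMap.proj i ∘ₗ g, fun x => ?_⟩
  conv_rhs => rw [← LinearMap.id_apply (R := R) x, ← h, LinearMap.comp_apply,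
    ← Finset.univ_sum_single (g x), map_sum]
  refine Finset.sum_congr rfl fun i _ => ?_
  rw [← map_smul, ← Pi.single_smul, smul_eq_mul, mul_one]
  rfl

variable {K : Type u} [Field K] {A : Type v} [Ring A] [Algebra K A]
  {B : Type w} [Ring B] [Algebra K B]

instance (M : Bimodule K A B) : SMulCommClass Bᵐᵒᵖ A M.carrier := SMulCommClass.symm _ _ _

attribute [local instance] TensorProduct.Algebra.module in
-- Expresses projectivity over the enveloping algebra through the two one-sided actions alone, so
-- that later arguments do not need the module structure over `A ⊗[K] Aᵐᵒᵖ`.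
theorem exists_bimodule_dualBasis (P : Bimodule K A A) [FiniteDimensional K P.carrier]
    (hP : IsProjectiveBimodule P) :
    ∃ (r : ℕ) (q : Fin r → P.carrier) (F : Fin r → P.carrier →ₗ[K] A ⊗[K] Aᵐᵒᵖ),
      (∀ i a x, F i (a • x) = (a ⊗ₜ 1) * F i x) ∧
      (∀ i b x, F i (b • x) = (1 ⊗ₜ b) * F i x) ∧
      ∀ x, ∑ i, TensorProduct.Algebra.moduleAux (F i x) (q i) = x := by
  have : Module.Projective (A ⊗[K] Aᵐᵒᵖ) P.carrier := hP
  have tower : IsScalarTower K (A ⊗[K] Aᵐᵒᵖ) P.carrier := ⟨fun c t x => by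
    change TensorProduct.Algebra.moduleAux (c • t) x = c • TensorProduct.Algebra.moduleAux t x
    simp⟩
  have : Module.Finite (A ⊗[K] Aᵐᵒᵖ) P.carrier := Module.Finite.of_restrictScalars_finite K _ _
  obtain ⟨r, q, F, h⟩ := exists_dualBasis (A ⊗[K] Aᵐᵒᵖ) P.carrier
  refine ⟨r, q, fun i => (F i).restrictScalars K, fun i a x => ?_, fun i b x => ?_, h⟩
  · have : a • x = (a ⊗ₜ[K] (1 : Aᵐᵒᵖ)) • x := by rw [TensorProduct.Algebra.smul_def, one_smul]
    simp [this]
  · have : b • x = ((1 : A) ⊗ₜ[K] b) • x := by rw [TensorProduct.Algebra.smul_def, one_smul]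
    simp [this]

/-- Contraction of the right factor of `R ⊗ S` by a linear form. -/
noncomputable def contractRight (R : Type*) {S : Type*} [Ring R] [Algebra K R] [Ring S]
    [Algebra K S] (ξ : S →ₗ[K] K) : R ⊗[K] S →ₗ[K] R :=
  (TensorProduct.rid K R).toLinearMap ∘ₗ LinearMap.lTensor R ξ

@[simp]
theorem contractRight_tmul {R S : Type*} [Ring R] [Algebra K R] [Ring S] [Algebra K S]
    (ξ : S →ₗ[K] K) (a : R) (b : S) : contractRight R ξ (a ⊗ₜ b) = ξ b • a := by
  simp [contractRight]

theorem contractRight_mul {R S : Type*} [Ring R] [Algebra K R] [Ring S] [Algebra K S]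
    (ξ : S →ₗ[K] K) (a : R) (t : R ⊗[K] S) :
    contractRight R ξ ((a ⊗ₜ 1) * t) = a * contractRight R ξ t := by
  induction t with
  | zero => simp
  | tmul x y => simp
  | add x y hx hy => rw [mul_add, map_add, map_add, hx, hy, mul_add]

/-- Contraction of the left factor of `R ⊗ S` by a linear form. -/
noncomputable def contractLeft {R : Type*} (S : Type*) [Ring R] [Algebra K R] [Ring S]
    [Algebra K S] (ξ : R →ₗ[K] K) : R ⊗[K] S →ₗ[K] S :=
  (TensorProduct.lid K S).toLinearMap ∘ₗ LinearMap.rTensor S ξ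

@[simp]
theorem contractLeft_tmul {R S : Type*} [Ring R] [Algebra K R] [Ring S] [Algebra K S]
    (ξ : R →ₗ[K] K) (a : R) (b : S) : contractLeft S ξ (a ⊗ₜ b) = ξ a • b := by
  simp [contractLeft]

theorem contractLeft_mul {R S : Type*} [Ring R] [Algebra K R] [Ring S] [Algebra K S]
    (ξ : R →ₗ[K] K) (b : S) (t : R ⊗[K] S) :
    contractLeft S ξ ((1 ⊗ₜ b) * t) = b * contractLeft S ξ t := by
  induction t with
  | zero => simp
  | tmul x y => simp
  | add x y hx hy => rw [mul_add, map_add, map_add, hx, hy, mul_add]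

/-- The enveloping algebra is free over `Aᵐᵒᵖ` on a basis of `A`; expanding the left tensor factor
in that basis gives a one-sided dual basis. -/
theorem projective_op_of_isProjectiveBimodule (P : Bimodule K A A) [FiniteDimensional K A]
    [FiniteDimensional K P.carrier] (hP : IsProjectiveBimodule P) :
    Module.Projective Aᵐᵒᵖ P.carrier := by
  obtain ⟨r, q, F, -, hF2, hF⟩ := exists_bimodule_dualBasis P hP
  let b := Module.finBasis K A
  let f : Fin r × Fin (Module.finrank K A) → P.carrier →ₗ[Aᵐᵒᵖ] Aᵐᵒᵖ := fun p =>
    { toFun := fun x => contractLeft Aᵐᵒᵖ (b.coord p.2) (F p.1 x)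
      map_add' := fun x y => by simp
      map_smul' := fun c x => by rw [hF2, contractLeft_mul]; rfl }
  refine projective_of_dualBasis (fun p => b p.2 • q p.1) f fun x => ?_
  have key : ∀ (t : A ⊗[K] Aᵐᵒᵖ) (y : P.carrier),
      ∑ k, contractLeft Aᵐᵒᵖ (b.coord k) t • b k • y = TensorProduct.Algebra.moduleAux t y := by
    intro t y
    induction t with
    | zero => simp
    | tmul a c =>
      rw [TensorProduct.Algebra.moduleAux_apply]
      conv_rhs => rw [← b.sum_repr a, Finset.sum_smul]
      refine Finset.sum_congr rfl fun k _ => ?_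
      rw [contractLeft_tmul, smul_assoc, smul_assoc, smul_comm c (b k) y]
      rfl
    | add s t hs ht => simp only [map_add, add_smul, Finset.sum_add_distrib, hs, ht,
        LinearMap.add_apply]
  rw [Fintype.sum_prod_type]
  conv_rhs => rw [← hF x]
  exact Finset.sum_congr rfl fun i _ => key (F i x) (q i)

/-- The left-hand analogue of `projective_op_of_isProjectiveBimodule`. The formula for `f` is
retained because the vanishing of traces on `P` is computed from it. -/
theorem exists_left_dualBasis (P : Bimodule K A A) [FiniteDimensional K A]
    [FiniteDimensional K P.carrier] (hP : IsProjectiveBimodule P) :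
    ∃ (r : ℕ) (q : Fin r → P.carrier) (F : Fin r → P.carrier →ₗ[K] A ⊗[K] Aᵐᵒᵖ)
      (f : Fin r × Fin (Module.finrank K Aᵐᵒᵖ) → P.carrier →ₗ[A] A),
      (∀ i b x, F i (b • x) = (1 ⊗ₜ b) * F i x) ∧
      (∀ p x, f p x = contractRight A ((Module.finBasis K Aᵐᵒᵖ).coord p.2) (F p.1 x)) ∧
      ∀ x, ∑ p, f p x • Module.finBasis K Aᵐᵒᵖ p.2 • q p.1 = x := by
  obtain ⟨r, q, F, hF1, hF2, hF⟩ := exists_bimodule_dualBasis P hP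
  let b := Module.finBasis K Aᵐᵒᵖ
  let f : Fin r × Fin (Module.finrank K Aᵐᵒᵖ) → P.carrier →ₗ[A] A := fun p =>
    { toFun := fun x => contractRight A (b.coord p.2) (F p.1 x)
      map_add' := fun x y => by simp
      map_smul' := fun c x => by rw [hF1, contractRight_mul]; rfl }
  refine ⟨r, q, F, f, hF2, fun _ _ => rfl, fun x => ?_⟩
  have key : ∀ (t : A ⊗[K] Aᵐᵒᵖ) (y : P.carrier),
      ∑ k, contractRight A (b.coord k) t • b k • y = TensorProduct.Algebra.moduleAux t y := by
    intro t y
    induction t with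
    | zero => simp
    | tmul a c =>
      rw [TensorProduct.Algebra.moduleAux_apply]
      conv_rhs => rw [← b.sum_repr c, Finset.sum_smul, Finset.smul_sum]
      refine Finset.sum_congr rfl fun k _ => ?_
      rw [contractRight_tmul, smul_assoc, smul_assoc, smul_comm a ((b.repr c) k)]
      rfl
    | add s t hs ht => simp only [map_add, add_smul, Finset.sum_add_distrib, hs, ht,
        LinearMap.add_apply]
  rw [Fintype.sum_prod_type]
  conv_rhs => rw [← hF x]
  exact Finset.sum_congr rfl fun i _ => key (F i x) (q i)

/-- For a projective bimodule `P` and a one-dimensional left module `S`, given by a character, the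
left module `P ⊗ S` is projective. -/
theorem projective_quotient_kerSpan (P : Bimodule K A A) [FiniteDimensional K P.carrier]
    (hP : IsProjectiveBimodule P) (χ : Aᵐᵒᵖ →ₐ[K] K) :
    Module.Projective A (P.carrier ⧸ kerSpan (R := Aᵐᵒᵖ) (V := P.carrier) A χ) := by
  obtain ⟨r, q, F, hF1, hF2, hF⟩ := exists_bimodule_dualBasis P hP
  have hχ : ∀ (b : Aᵐᵒᵖ) (t : A ⊗[K] Aᵐᵒᵖ), contractRight A χ.toLinearMap ((1 ⊗ₜ b) * t) =
      χ b • contractRight A χ.toLinearMap t := by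
    intro b t
    induction t with
    | zero => simp
    | tmul x y => simp [mul_smul]
    | add x y hx hy => rw [mul_add, map_add, map_add, hx, hy, smul_add]
  let f : Fin r → P.carrier →ₗ[A] A := fun i =>
    { toFun := fun x => contractRight A χ.toLinearMap (F i x)
      map_add' := fun x y => by simp
      map_smul' := fun c x => by rw [hF1, contractRight_mul]; rfl }
  -- Contracting with `χ` turns the right action into scalars, so the coordinate functionals descend
  -- to the quotient.
  have hf : ∀ i, kerSpan (R := Aᵐᵒᵖ) (V := P.carrier) A χ ≤ LinearMap.ker (f i) := by
    intro i
    refine Submodule.span_le.mpr ?_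
    rintro _ ⟨x, y, hx, rfl⟩
    change contractRight A χ.toLinearMap (F i (x • y)) = 0
    rw [hF2, hχ, hx, zero_smul]
  refine projective_of_dualBasis (fun i => (kerSpan (R := Aᵐᵒᵖ) A χ).mkQ (q i))
    (fun i => (kerSpan (R := Aᵐᵒᵖ) A χ).liftQ (f i) (hf i)) fun x => ?_
  obtain ⟨x, rfl⟩ := Submodule.mkQ_surjective _ x
  have key : ∀ (t : A ⊗[K] Aᵐᵒᵖ) (y : P.carrier),
      contractRight A χ.toLinearMap t • (kerSpan (R := Aᵐᵒᵖ) A χ).mkQ y =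
        (kerSpan (R := Aᵐᵒᵖ) A χ).mkQ (TensorProduct.Algebra.moduleAux t y) := by
    intro t y
    induction t with
    | zero => simp
    | tmul a c =>
      rw [TensorProduct.Algebra.moduleAux_apply, contractRight_tmul, map_smul, AlgHom.toLinearMap_apply,
        smul_assoc, smul_comm, ← algebraMap_smul A (χ c), ← map_smul (kerSpan (R := Aᵐᵒᵖ) A χ).mkQ,
        algebraMap_smul]
      congr 1
      rw [eq_comm, ← sub_eq_zero, ← map_sub, Submodule.mkQ_apply, Submodule.Quotient.mk_eq_zero]
      refine Submodule.subset_span ⟨c - algebraMap K Aᵐᵒᵖ (χ c), y,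
        by rw [map_sub, AlgHom.commutes, Algebra.algebraMap_self_apply, sub_self], ?_⟩
      rw [sub_smul, algebraMap_smul]
    | add s t hs ht => simp only [map_add, add_smul, hs, ht, LinearMap.add_apply]
  conv_rhs => rw [← hF x, map_sum]
  exact Finset.sum_congr rfl fun i _ => key (F i x) (q i)

end DualBases

/-! ### Cartan matrices under stable equivalences -/

section Cartan

variable {K : Type u} [Field K] {A : Type v} [Ring A] [Algebra K A]
  {B : Type w} [Ring B] [Algebra K B] {n n' : ℕ}

/-- The subspace `e V f` of a bimodule `V`. -/
def corner (K : Type*) [Field K] {A B : Type*} [Ring A] [Algebra K A] [Ring B] [Algebra K B]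
    (V : Type*) [AddCommGroup V] [Module K V] [Module A V] [Module Bᵐᵒᵖ V]
    [IsScalarTower K A V] [IsScalarTower K Bᵐᵒᵖ V] (e : A) (f : B) : Submodule K V :=
  LinearMap.range (Algebra.lsmul K K V e ∘ₗ Algebra.lsmul K K V (MulOpposite.op f))

theorem finrank_peirce_op (e f : A) :
    Module.finrank K (peirce K (MulOpposite.op e) (MulOpposite.op f)) =
      Module.finrank K (peirce K f e) := by
  have : peirce K (MulOpposite.op e) (MulOpposite.op f) =
      (peirce K f e).map (MulOpposite.opLinearEquiv K : A ≃ₗ[K] Aᵐᵒᵖ).toLinearMap := by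
    ext x
    constructor
    · rintro ⟨y, rfl⟩
      exact ⟨f * (y.unop * e), ⟨y.unop, rfl⟩, MulOpposite.unop_injective (by simp [mul_assoc])⟩
    · rintro ⟨_, ⟨y, rfl⟩, rfl⟩
      exact ⟨MulOpposite.op y, MulOpposite.unop_injective (by simp [mul_assoc])⟩
  rw [this]
  exact LinearEquiv.finrank_map_eq _ _

theorem finrank_corner_of_projective_right (S : SplitIdempotents K B n) [FiniteDimensional K B]
    (M : Bimodule K A B) [FiniteDimensional K M.carrier] [Module.Projective Bᵐᵒᵖ M.carrier]
    (e : A) (he : e * e = e) (j : Fin n) :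
    Module.finrank K (corner K M.carrier e (S.e j)) =
      ∑ l, multiplicity (S.op.π l) (LinearMap.range (Algebra.lsmul K K M.carrier e)) *
        Module.finrank K (peirce K (S.e l) (S.e j)) := by
  have h := S.op.finrank_range (V := M.carrier) (Algebra.lsmul K Bᵐᵒᵖ M.carrier e)
    (fun x => by simp [smul_smul, he]) j
  have hc : corner K M.carrier e (S.e j) = LinearMap.range
      (Algebra.lsmul K K M.carrier (S.op.e j) ∘ₗ
        (Algebra.lsmul K Bᵐᵒᵖ M.carrier e).restrictScalars K) := by
    unfold corner
    congr 1
    ext x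
    exact smul_comm e (MulOpposite.op (S.e j)) x
  rw [hc, h]
  refine Finset.sum_congr rfl fun l _ => ?_
  rw [mul_comm]
  congr 1
  exact finrank_peirce_op _ _

/-- Together with the count from the right, this computes one corner in two ways, which is the
relation m D = C m'. -/
theorem finrank_corner_of_projective_left (S : SplitIdempotents K A n) [FiniteDimensional K A]
    (M : Bimodule K A B) [FiniteDimensional K M.carrier] [Module.Projective A M.carrier]
    (f : B) (hf : f * f = f) (i : Fin n) :
    Module.finrank K (corner K M.carrier (S.e i) f) =
      ∑ k, Module.finrank K (peirce K (S.e i) (S.e k)) *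
        multiplicity (S.π k)
          (LinearMap.range (Algebra.lsmul K K M.carrier (MulOpposite.op f))) :=
  S.finrank_range (V := M.carrier) (Algebra.lsmul K A M.carrier (MulOpposite.op f))
    (fun x => by simp [smul_smul, ← MulOpposite.op_mul, hf]) i

/-- The quotient P/P(ker χ) is a projective left module, so the dimensions of its `e i`-parts form
an integral combination of columns of the Cartan matrix. This is the source of the term C p. -/
theorem multiplicity_of_isProjectiveBimodule (S : SplitIdempotents K A n) [FiniteDimensional K A]
    (P : Bimodule K A A) [FiniteDimensional K P.carrier] (hP : IsProjectiveBimodule P)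
    (χ : Aᵐᵒᵖ →ₐ[K] K) :
    ∃ p : Fin n → ℕ, ∀ i,
      multiplicity χ (LinearMap.range (Algebra.lsmul K K P.carrier (S.e i))) =
        ∑ k, Module.finrank K (peirce K (S.e i) (S.e k)) * p k := by
  have := projective_quotient_kerSpan P hP χ
  -- The left and right actions commute, so the `A`-span and the `K`-span of (ker χ)P agree.
  have hker : ∀ x, x ∈ kerSpan (R := Aᵐᵒᵖ) (V := P.carrier) A χ ↔
      x ∈ kerSpan (R := Aᵐᵒᵖ) (V := P.carrier) K χ := by
    intro x
    constructor
    · intro hx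
      induction hx using Submodule.span_induction with
      | mem x hx => exact Submodule.subset_span hx
      | zero => exact zero_mem _
      | add x y _ _ hx hy => exact add_mem hx hy
      | smul a x hx' hx =>
        clear hx'
        induction hx using Submodule.span_induction with
        | mem x hx =>
          obtain ⟨b, y, hb, rfl⟩ := hx
          exact Submodule.subset_span ⟨b, a • y, hb, smul_comm _ _ _⟩
        | zero => simp
        | add x y _ _ hx hy => rw [smul_add]; exact add_mem hx hy
        | smul c x _ hx => rw [smul_comm]; exact Submodule.smul_mem _ _ hx
    · intro hx
      induction hx using Submodule.span_induction with
      | mem x hx => exact Submodule.subset_span hx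
      | zero => exact zero_mem _
      | add x y _ _ hx hy => exact add_mem hx hy
      | smul c x _ hx => rw [← algebraMap_smul A]; exact Submodule.smul_mem _ _ hx
  have key := S.finrank_range (V := P.carrier ⧸ kerSpan (R := Aᵐᵒᵖ) (V := P.carrier) A χ)
    LinearMap.id (fun x => rfl)
  refine ⟨_, fun i => Eq.trans ?_ (key i)⟩
  rw [multiplicity, ← LinearMap.range_comp]
  set Q := (kerSpan (R := Aᵐᵒᵖ) (V := P.carrier) A χ).mkQ.restrictScalars K
  have hr : LinearMap.range (Algebra.lsmul K K
      (P.carrier ⧸ kerSpan (R := Aᵐᵒᵖ) (V := P.carrier) A χ) (S.e i) ∘ₗ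
      (LinearMap.id (R := A)).restrictScalars K) =
      LinearMap.range (Q ∘ₗ Algebra.lsmul K K P.carrier (S.e i)) := by
    ext y
    constructor
    · rintro ⟨x, rfl⟩
      obtain ⟨x, rfl⟩ := Submodule.mkQ_surjective _ x
      exact ⟨x, map_smul (kerSpan (R := Aᵐᵒᵖ) (V := P.carrier) A χ).mkQ _ _⟩
    · rintro ⟨x, rfl⟩
      exact ⟨Q x, (map_smul (kerSpan (R := Aᵐᵒᵖ) (V := P.carrier) A χ).mkQ _ _).symm⟩
  rw [hr]
  have h1 := LinearMap.finrank_range_add_finrank_ker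
    (Q ∘ₗ Algebra.lsmul K K P.carrier (S.e i))
  have h2 := LinearMap.finrank_range_add_finrank_ker
    ((kerSpan (R := Aᵐᵒᵖ) (V := P.carrier) K χ).mkQ ∘ₗ Algebra.lsmul K K P.carrier (S.e i))
  have h3 : LinearMap.ker (Q ∘ₗ Algebra.lsmul K K P.carrier (S.e i)) = LinearMap.ker
      ((kerSpan (R := Aᵐᵒᵖ) (V := P.carrier) K χ).mkQ ∘ₗ
        Algebra.lsmul K K P.carrier (S.e i)) := by
    ext x
    simp only [LinearMap.mem_ker, LinearMap.comp_apply, Q, LinearMap.restrictScalars_apply,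
      Submodule.mkQ_apply, Submodule.Quotient.mk_eq_zero, hker]
  rw [h3] at h1
  omega

theorem finrank_corner_prod (P : Bimodule K A A) [FiniteDimensional K A]
    [FiniteDimensional K P.carrier] (e f : A) :
    Module.finrank K (corner K (A × P.carrier) e f) =
      Module.finrank K (peirce K e f) + Module.finrank K (corner K P.carrier e f) := by
  have h : corner K (A × P.carrier) e f = (peirce K e f).prod (corner K P.carrier e f) := by
    rw [peirce, corner, corner, ← LinearMap.range_prodMap]
    rfl
  rw [h, ← Module.finrank_prod, ← LinearMap.finrank_range_of_inj (f :=
    (peirce K e f).subtype.prodMap (corner K P.carrier e f).subtype)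
    (Function.Injective.prodMap (Submodule.subtype_injective _) (Submodule.subtype_injective _)),
    LinearMap.range_prodMap, Submodule.range_subtype, Submodule.range_subtype]

theorem balanced_ext {M : Bimodule K A B} {N : Bimodule K B A} {W : Type*} [AddCommGroup W]
    [Module K W] {f g : BalancedTensor M N →ₗ[K] W}
    (h : ∀ m n, f (balancedTmul M N m n) = g (balancedTmul M N m n)) : f = g :=
  Submodule.linearMap_qext _ (TensorProduct.ext' h)

theorem balancedTmul_smul (M : Bimodule K A B) (N : Bimodule K B A) (m : M.carrier) (b : B)
    (x : N.carrier) :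
    balancedTmul M N (MulOpposite.op b • m) x = balancedTmul M N m (b • x) := by
  rw [balancedTmul, balancedTmul, ← sub_eq_zero, ← map_sub, Submodule.mkQ_apply,
    Submodule.Quotient.mk_eq_zero]
  exact Submodule.subset_span ⟨m, b, x, rfl⟩

/-- The linear map out of `M ⊗[B] N` given by a balanced bilinear map. -/
def balancedLift (M : Bimodule K A B) (N : Bimodule K B A) {W : Type*} [AddCommGroup W]
    [Module K W] (f : M.carrier →ₗ[K] N.carrier →ₗ[K] W)
    (hf : ∀ m (b : B) x, f (MulOpposite.op b • m) x = f m (b • x)) :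
    BalancedTensor M N →ₗ[K] W :=
  (balancingSubmodule M N).liftQ (TensorProduct.lift f) (by
    rw [balancingSubmodule, Submodule.span_le]
    rintro _ ⟨m, b, x, rfl⟩
    simp [hf])

@[simp]
theorem balancedLift_tmul (M : Bimodule K A B) (N : Bimodule K B A) {W : Type*} [AddCommGroup W]
    [Module K W] (f : M.carrier →ₗ[K] N.carrier →ₗ[K] W)
    (hf : ∀ m (b : B) x, f (MulOpposite.op b • m) x = f m (b • x)) (m : M.carrier)
    (x : N.carrier) : balancedLift M N f hf (balancedTmul M N m x) = f m x := by
  simp [balancedLift, balancedTmul]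

/-- The class of `m ⊗ x` as a bilinear map. -/
def balancedMk (M : Bimodule K A B) (N : Bimodule K B A) :
    M.carrier →ₗ[K] N.carrier →ₗ[K] BalancedTensor M N :=
  (TensorProduct.mk K M.carrier N.carrier).compr₂ (balancingSubmodule M N).mkQ

theorem balancedMk_apply (M : Bimodule K A B) (N : Bimodule K B A) (m : M.carrier)
    (x : N.carrier) : balancedMk M N m x = balancedTmul M N m x := rfl

/-- As a right module e M is a direct sum of modules `e j B`, and tensoring over `B` turns each
summand into `e j N`. -/
theorem finrank_corner_of_tensorIso (S : SplitIdempotents K B n) (M : Bimodule K A B)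
    (N : Bimodule K B A) (P : Bimodule K A A) [FiniteDimensional K M.carrier]
    [FiniteDimensional K N.carrier] [Module.Projective Bᵐᵒᵖ M.carrier]
    (hΦ : TensorIsoRegularSum M N P) (e e' : A) (he : e * e = e) (he' : e' * e' = e') :
    Module.finrank K (corner K (A × P.carrier) e e') =
      ∑ j, multiplicity (S.op.π j) (LinearMap.range (Algebra.lsmul K K M.carrier e)) *
        Module.finrank K (corner K N.carrier (S.e j) e') := by
  classical
  obtain ⟨Φ, hΦ1, hΦ2⟩ := hΦ
  obtain ⟨v, g, hev, hεv, hge, hgv, hgsum⟩ := S.op.exists_basis (V := M.carrier)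
    (Algebra.lsmul K Bᵐᵒᵖ M.carrier e) (fun x => by simp [smul_smul, he])
  simp only [Algebra.lsmul_coe] at hεv hgsum
  have hidem : ∀ j, S.e j * S.e j = S.e j := fun j => (S.complete.idem j).eq
  -- The t-th coordinate m ⊗ x ↦ g t (m) x of e M ⊗ N; these maps give the decomposition.
  let Θ := fun t => balancedLift M N
    (LinearMap.mk₂ K (fun m x => (g t m).unop • x) (by simp [add_smul])
      (fun c m x => by
        rw [← LinearMap.coe_restrictScalars K (g t), map_smul, MulOpposite.unop_smul, smul_assoc])
      (by simp) (fun c m x => smul_comm _ _ _))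
    (fun m b x => by simp [mul_smul])
  have hΘ : ∀ t m x, Θ t (balancedTmul M N m x) = (g t m).unop • x :=
    fun t m x => balancedLift_tmul M N _ _ m x
  have hright : ∀ t (a : A) y, Θ t (Φ.symm (MulOpposite.op a • y)) =
      MulOpposite.op a • Θ t (Φ.symm y) := by
    intro t a y
    have : Θ t ∘ₗ Φ.symm.toLinearMap ∘ₗ Algebra.lsmul K K _ (MulOpposite.op a) ∘ₗ Φ.toLinearMap =
        Algebra.lsmul K K _ (MulOpposite.op a) ∘ₗ Θ t := balanced_ext fun m x => by
      simp only [LinearMap.comp_apply, LinearEquiv.coe_coe, Algebra.lsmul_coe]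
      rw [← hΦ2, Φ.symm_apply_apply, hΘ, hΘ, smul_comm]
    simpa using LinearMap.congr_fun this (Φ.symm y)
  have hleft : ∀ t x, S.e t.1 • Θ t x = Θ t x := by
    intro t x
    have : Algebra.lsmul K K _ (S.e t.1) ∘ₗ Θ t = Θ t := balanced_ext fun m x => by
      simp only [LinearMap.comp_apply, Algebra.lsmul_coe]
      rw [hΘ, smul_smul]
      conv_rhs => rw [← hge]
      rfl
    exact LinearMap.congr_fun this x
  have hsum : ∀ y, Φ (∑ t, balancedTmul M N (v t) (Θ t (Φ.symm y))) = e • y := by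
    intro y
    have : (∑ t, (Φ.toLinearMap ∘ₗ balancedMk M N (v t) ∘ₗ Θ t)) =
        Algebra.lsmul K K _ e ∘ₗ Φ.toLinearMap := balanced_ext fun m x => by
      simp only [LinearMap.sum_apply, LinearMap.comp_apply, LinearEquiv.coe_coe,
        Algebra.lsmul_coe, balancedMk_apply]
      rw [← hΦ1, ← hgsum, ← map_sum]
      congr 1
      rw [← balancedMk_apply M N (∑ t, _), map_sum, LinearMap.sum_apply]
      refine Finset.sum_congr rfl fun t _ => ?_
      rw [balancedMk_apply, hΘ, ← balancedTmul_smul, MulOpposite.op_unop]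
    have := LinearMap.congr_fun this (Φ.symm y)
    simpa [balancedMk_apply] using this
  have hfix : ∀ y ∈ corner K (A × P.carrier) e e', e • y = y ∧ MulOpposite.op e' • y = y := by
    rintro _ ⟨x, rfl⟩
    simp only [LinearMap.comp_apply, Algebra.lsmul_coe]
    refine ⟨by rw [smul_smul, he], ?_⟩
    rw [smul_comm _ e, smul_smul, ← MulOpposite.op_mul, he']
  have hmem : ∀ (f : B) (x : N.carrier), f • x = x → MulOpposite.op e' • x = x →
      x ∈ corner K N.carrier f e' := fun f x h h' => ⟨x, by simp [h, h']⟩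
  have hfix' : ∀ j, ∀ x ∈ corner K N.carrier (S.e j) e',
      S.e j • x = x ∧ MulOpposite.op e' • x = x := by
    rintro j _ ⟨x, rfl⟩
    simp only [LinearMap.comp_apply, Algebra.lsmul_coe]
    refine ⟨by rw [smul_smul, hidem], ?_⟩
    rw [smul_comm _ (S.e j), smul_smul, ← MulOpposite.op_mul, he']
  let F : corner K (A × P.carrier) e e' →ₗ[K]
      (∀ t : Σ i, Fin (multiplicity (S.op.π i)
        ((LinearMap.range (Algebra.lsmul K Bᵐᵒᵖ M.carrier e)).restrictScalars K)),
        corner K N.carrier (S.e t.1) e') :=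
    LinearMap.pi fun t => LinearMap.codRestrict _
      (Θ t ∘ₗ Φ.symm.toLinearMap ∘ₗ Submodule.subtype _) (fun y => by
        refine hmem _ _ (hleft t _) ?_
        change MulOpposite.op e' • Θ t (Φ.symm y) = Θ t (Φ.symm y)
        rw [← hright, (hfix y y.2).2])
  have hF : ∀ y t, (F y t : N.carrier) = Θ t (Φ.symm y) := fun y t => rfl
  have hbij : Function.Bijective F := by
    constructor
    · rw [injective_iff_map_eq_zero]
      intro y hy
      apply Subtype.ext
      rw [← (hfix y y.2).1, ← hsum, ZeroMemClass.coe_zero, ← map_zero Φ]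
      congr 1
      refine Finset.sum_eq_zero fun t _ => ?_
      rw [← hF, hy, ← balancedMk_apply]
      simp
    · intro c
      have hc := fun t => hfix' _ _ (c t).2
      refine ⟨⟨Φ (∑ t, balancedTmul M N (v t) (c t)),
        ⟨Φ (∑ t, balancedTmul M N (v t) (c t)), ?_⟩⟩, ?_⟩
      · simp only [LinearMap.comp_apply, Algebra.lsmul_coe, map_sum, ← hΦ1, ← hΦ2,
          (hc _).2, hεv]
      · funext t
        apply Subtype.ext
        rw [hF]
        simp only [LinearEquiv.symm_apply_apply, map_sum, hΘ, hgv]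
        rw [Finset.sum_eq_single t]
        · rw [if_pos rfl]; exact (hc t).1
        · intro s _ hs
          simp [hs]
        · simp
  rw [(LinearEquiv.ofBijective F hbij).finrank_eq, Module.finrank_pi_fintype,
    Fintype.sum_sigma]
  refine Finset.sum_congr rfl fun i _ => ?_
  refine (Finset.sum_const (Module.finrank K (corner K N.carrier (S.e i) e'))).trans ?_
  rw [Finset.card_univ, Fintype.card_fin, smul_eq_mul]
  rfl

/-- A block factorization, which allows `C` and `D` to have different sizes: the left side has
determinant det D, and one factor on the right has determinant det C. -/
theorem det_dvd_det {a b : Type*} [Fintype a] [Fintype b] [DecidableEq a] [DecidableEq b]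
    (C : Matrix a a ℤ) (D : Matrix b b ℤ) (m m' : Matrix a b ℤ) (n : Matrix b a ℤ)
    (p : Matrix a a ℤ) (h : m * D = C * m') (h' : m * n = 1 + C * p) : C.det ∣ D.det := by
  have key : Matrix.fromBlocks D (-n) 0 1 =
      Matrix.fromBlocks 1 0 (-m) C * Matrix.fromBlocks D (-n) m' (-p) := by
    rw [Matrix.fromBlocks_multiply]
    simp [h, h']
  have := congrArg Matrix.det key
  rw [Matrix.det_mul, Matrix.det_fromBlocks_zero₂₁, Matrix.det_fromBlocks_zero₁₂] at this
  simp only [Matrix.det_one, mul_one, one_mul] at this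
  exact ⟨_, this⟩

/-- The integral Cartan matrix. -/
noncomputable def SplitIdempotents.cartan (S : SplitIdempotents K A n) :
    Matrix (Fin n) (Fin n) ℤ :=
  Matrix.of fun i j => (Module.finrank K (peirce K (S.e i) (S.e j)) : ℤ)

theorem finiteDimensional_of_tensorIso {M : Bimodule K A B} {N : Bimodule K B A}
    {P : Bimodule K A A} [FiniteDimensional K M.carrier] [FiniteDimensional K N.carrier]
    (h : TensorIsoRegularSum M N P) : FiniteDimensional K P.carrier := by
  obtain ⟨Φ, -⟩ := h
  exact Module.Finite.of_surjective (LinearMap.snd K A P.carrier ∘ₗ Φ.toLinearMap)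
    (Prod.snd_surjective.comp Φ.surjective)

/-- If `A` and `B` are stably equivalent of Morita type and the Cartan matrix of `A` is
non-singular, its determinant divides that of `B`. -/
theorem StablyEquivalentOfMoritaType.det_cartan_dvd (h : StablyEquivalentOfMoritaType K A B)
    [FiniteDimensional K A] [FiniteDimensional K B] (S : SplitIdempotents K A n)
    (S' : SplitIdempotents K B n') (hdet : S.cartan.det ≠ 0) :
    S.cartan.det ∣ S'.cartan.det := by
  obtain ⟨M, N, P, Q, _, _, _, _, _, _, hP, -, hMN, -⟩ := h
  have := finiteDimensional_of_tensorIso hMN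
  have := projective_op_of_isProjectiveBimodule P hP
  have idem : ∀ i, S.e i * S.e i = S.e i := fun i => (S.complete.idem i).eq
  have idem' : ∀ i, S'.e i * S'.e i = S'.e i := fun i => (S'.complete.idem i).eq
  choose p hp using fun l => multiplicity_of_isProjectiveBimodule S P hP (S.op.π l)
  let m : Matrix (Fin n) (Fin n') ℤ := Matrix.of fun i j =>
    (multiplicity (S'.op.π j) (LinearMap.range (Algebra.lsmul K K M.carrier (S.e i))) : ℤ)
  let m' : Matrix (Fin n) (Fin n') ℤ := Matrix.of fun i j => (multiplicity (S.π i)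
    (LinearMap.range (Algebra.lsmul K K M.carrier (MulOpposite.op (S'.e j)))) : ℤ)
  let q : Matrix (Fin n') (Fin n) ℤ := Matrix.of fun j i =>
    (multiplicity (S.op.π i) (LinearMap.range (Algebra.lsmul K K N.carrier (S'.e j))) : ℤ)
  let p' : Matrix (Fin n) (Fin n) ℤ := Matrix.of fun k l => (p l k : ℤ)
  refine det_dvd_det S.cartan S'.cartan m m' q p' ?_ ?_
  · ext i j
    have h1 := finrank_corner_of_projective_right S' M (S.e i) (idem i) j
    rw [finrank_corner_of_projective_left S M (S'.e j) (idem' j) i] at h1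
    have h2 := congrArg (Nat.cast (R := ℤ)) h1
    push_cast at h2
    simp only [Matrix.mul_apply, SplitIdempotents.cartan, Matrix.of_apply, m, m']
    exact h2.symm
  -- Both sides count the corners of M ⊗ N ≅ A ⊕ P. The right-hand factor is then cancelled using
  -- its adjugate, which is where non-singularity enters.
  · have key : (m * q) * S.cartan = (1 + S.cartan * p') * S.cartan := by
      ext i j
      have h1 := finrank_corner_prod P (S.e i) (S.e j)
      rw [finrank_corner_of_tensorIso S' M N P hMN _ _ (idem i) (idem j),
        finrank_corner_of_projective_right S P (S.e i) (idem i) j] at h1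
      simp only [finrank_corner_of_projective_right S N _ (idem' _) j, hp] at h1
      have h2 := congrArg (Nat.cast (R := ℤ)) h1
      push_cast at h2
      rw [Matrix.mul_assoc, Matrix.add_mul, Matrix.one_mul, Matrix.add_apply]
      simp only [Matrix.mul_apply, SplitIdempotents.cartan, Matrix.of_apply, m, q, p']
      exact h2
    have hinv : Function.Injective fun X : Matrix (Fin n) (Fin n) ℤ => X * S.cartan := by
      intro X Y hXY
      have := congrArg (fun Z => Z * S.cartan.adjugate) hXY
      simp only [Matrix.mul_assoc, Matrix.mul_adjugate, Matrix.mul_smul, mul_one] at this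
      exact smul_right_injective _ hdet this
    exact hinv key

end Cartan

/-! ### Basic symmetric algebras -/

section Basic

variable {K : Type u} [Field K] {A : Type v} [Ring A] [Algebra K A]

theorem IsBasic.exists_algHom (hb : IsBasic K A) :
    ∃ (N : ℕ) (ρ : A →ₐ[K] (Fin N → K)), Function.Surjective ρ ∧
      ∀ a, ρ a = 0 ↔ a ∈ Ring.jacobson A := by
  obtain ⟨N, ⟨ψ⟩⟩ := hb
  refine ⟨N, ψ.toAlgHom.comp (Ideal.Quotient.mkₐ K (Ring.jacobson A)),
    ψ.surjective.comp (Ideal.Quotient.mkₐ_surjective K _), fun a => ?_⟩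
  change ψ (Ideal.Quotient.mk _ a) = 0 ↔ _
  rw [map_eq_zero_iff ψ ψ.injective, Ideal.Quotient.eq_zero_iff_mem]

theorem isNilpotent_of_mem_jacobson (K : Type u) [Field K] {A : Type v} [Ring A] [Algebra K A]
    [FiniteDimensional K A] {a : A} (ha : a ∈ Ring.jacobson A) : IsNilpotent a := by
  have : IsArtinianRing A := isArtinian_of_tower K inferInstance
  obtain ⟨k, hk⟩ := IsSemiprimaryRing.isNilpotent (R := A)
  refine ⟨k, ?_⟩
  have := Ideal.pow_mem_pow ha k
  rw [hk] at this
  simpa using this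

/-- Modulo the radical, primitive idempotents become coordinate idempotents of K × ⋯ × K, and
completeness makes every coordinate occur exactly once. The coordinate projections then supply the
dual characters. -/
theorem IsBasic.exists_splitIdempotents [FiniteDimensional K A] (hb : IsBasic K A) {n : ℕ}
    (e : Fin n → A) (he : CompleteOrthogonalIdempotents e)
    (hprim : ∀ i, IsPrimitiveIdempotent (e i)) : ∃ S : SplitIdempotents K A n, S.e = e := by
  classical
  obtain ⟨N, ρ, hρ, hker⟩ := hb.exists_algHom
  have hnil : ∀ x ∈ RingHom.ker ρ.toRingHom, IsNilpotent x := fun x hx =>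
    isNilpotent_of_mem_jacobson K ((hker x).mp hx)
  have hσ : ∀ j, ∃ i, ρ (e j) = Pi.single i 1 := by
    intro j
    obtain ⟨hidem, hne, hsplit⟩ := hprim j
    have hρidem : ρ (e j) * ρ (e j) = ρ (e j) := by rw [← map_mul, hidem.eq]
    obtain ⟨i, hi⟩ : ∃ i, ρ (e j) i ≠ 0 := by
      by_contra! hcon
      obtain ⟨k, hk⟩ := hnil (e j) (funext hcon)
      cases k with
      | zero => exact hne (by rw [← mul_one (e j), ← pow_zero (e j), hk, mul_zero])
      | succ k => exact hne (by rw [← hidem.pow_succ_eq k, hk])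
    have hi1 : ρ (e j) i = 1 := mul_right_cancel₀ hi (by rw [one_mul]; exact congrFun hρidem i)
    have hs : (Pi.single i 1 : Fin N → K) * ρ (e j) = Pi.single i 1 := by
      rw [← Pi.single_mul_left, hi1, one_mul]
    -- A coordinate idempotent lifts to an idempotent orthogonal to `1 - e j`, hence lying below `e
    -- j`; primitivity forces it to equal `e j`.
    obtain ⟨f, hf, hf1, hf2, hf3⟩ := exists_isIdempotentElem_mul_eq_zero_of_ker_isNilpotent
      ρ.toRingHom hnil (Pi.single i 1) (hρ _)
      (by rw [IsIdempotentElem, ← Pi.single_mul, one_mul]) (1 - e j) hidem.one_sub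
      (by
        change Pi.single i 1 * ρ (1 - e j) = 0
        rw [map_sub, map_one, mul_sub, mul_one, hs, sub_self])
      (by
        change ρ (1 - e j) * Pi.single i 1 = 0
        rw [map_sub, map_one, sub_mul, one_mul, mul_comm, hs, sub_self])
    rw [mul_sub, mul_one, sub_eq_zero] at hf2
    rw [sub_mul, one_mul, sub_eq_zero] at hf3
    refine ⟨i, ?_⟩
    rcases hsplit f (e j - f) hf
      (by rw [IsIdempotentElem, sub_mul, mul_sub, mul_sub, hidem.eq, ← hf2, ← hf3, hf.eq]; abel)
      (by rw [mul_sub, ← hf2, hf.eq, sub_self]) (by rw [sub_mul, ← hf3, hf.eq, sub_self])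
      (by abel) with h | h
    · exfalso
      have h0 : ρ f = 0 := by rw [h, map_zero]
      have : (Pi.single i 1 : Fin N → K) i = 0 := by
        rw [← hf1]; exact congrFun h0 i
      simp at this
    · rw [sub_eq_zero.mp h]; exact hf1
  choose σ hσ using hσ
  have hinj : ∀ i j, i ≠ j → σ i ≠ σ j := by
    intro i j hij h
    have h0 : ρ (e i) * ρ (e j) = 0 := by rw [← map_mul, he.ortho hij, map_zero]
    have := congrFun h0 (σ i)
    simp [hσ, h] at this
  have hsurj : ∀ i, ∃ j, σ j = i := by
    intro i
    by_contra! hcon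
    have h1 := congrFun (congrArg ρ he.complete) i
    simp only [map_sum, hσ, map_one, Finset.sum_apply, Pi.one_apply] at h1
    rw [Finset.sum_eq_zero] at h1
    · exact zero_ne_one h1
    · intro j _
      exact Pi.single_eq_of_ne (hcon j).symm _
  refine ⟨⟨e, he, fun j => (Pi.evalAlgHom K (fun _ => K) (σ j)).comp ρ, fun i j => ?_,
    fun a ha => ?_⟩, rfl⟩
  · change ρ (e j) (σ i) = _
    rw [hσ]
    split_ifs with h
    · rw [h, Pi.single_eq_same]
    · exact Pi.single_eq_of_ne (hinj i j h) _
  · refine hnil a (funext fun i => ?_)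
    obtain ⟨j, rfl⟩ := hsurj i
    exact ha j

theorem mem_socle_of_smul_eq (ρ : A →ₐ[K] K) {y : A} (hy : ∀ a, a * y = ρ a • y) :
    y ∈ socle A := by
  by_cases h0 : y = 0
  · rw [h0]; exact zero_mem _
  refine (le_sSup (a := Submodule.span A {y}) ?_ : _ ≤ socle A) (Submodule.mem_span_singleton_self y)
  rw [Set.mem_ofPred_eq, isSimpleModule_iff_toSpanSingleton_surjective]
  have hmem : ∀ x ∈ Submodule.span A {y}, ∃ c : K, x = c • y := by
    intro x hx
    obtain ⟨a, rfl⟩ := Submodule.mem_span_singleton.mp hx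
    exact ⟨ρ a, hy a⟩
  refine ⟨⟨⟨⟨y, Submodule.mem_span_singleton_self y⟩, 0, fun h => h0 (congrArg Subtype.val h)⟩⟩,
    ?_⟩
  rintro ⟨x, hx⟩ hx0 ⟨z, hz⟩
  obtain ⟨c, rfl⟩ := hmem x hx
  obtain ⟨d, rfl⟩ := hmem z hz
  have hc : c ≠ 0 := by
    rintro rfl
    exact hx0 (Subtype.ext (zero_smul _ _))
  refine ⟨algebraMap K A (d / c), Subtype.ext ?_⟩
  change algebraMap K A (d / c) • c • y = d • y
  rw [algebraMap_smul, smul_smul, div_mul_cancel₀ _ hc]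

/-- The radical kills simple modules. Conversely, an element killed by the radical splits along
lifts of the coordinate idempotents into pieces on which `A` acts by characters; these need not be
idempotent lifts. -/
theorem IsBasic.mem_socle_iff (hb : IsBasic K A) (z : A) :
    z ∈ socle A ↔ ∀ j ∈ Ring.jacobson A, j * z = 0 := by
  classical
  constructor
  · intro hz
    let T : Submodule A A :=
      { carrier := {x | ∀ j ∈ Ring.jacobson A, j * x = 0}
        add_mem' := fun hx hy j hj => by rw [mul_add, hx j hj, hy j hj, add_zero]
        zero_mem' := fun j _ => mul_zero j
        smul_mem' := fun a x hx j hj => by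
          rw [smul_eq_mul, ← mul_assoc]
          exact hx _ (Ideal.mul_mem_right _ _ hj) }
    have : socle A ≤ T := by
      refine sSup_le fun S hS x hx j hj => ?_
      have hS : IsSimpleModule A S := hS
      have := Module.mem_annihilator.mp (IsSemisimpleModule.jacobson_le_annihilator A S hj) ⟨x, hx⟩
      exact congrArg Subtype.val this
    exact this hz
  · intro hz
    obtain ⟨N, ρ, hρ, hker⟩ := hb.exists_algHom
    choose ε hε using fun i => hρ (Pi.single i 1)
    have hsum : z = ∑ i, ε i * z := by
      have : (1 - ∑ i, ε i) * z = 0 := by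
        refine hz _ ((hker _).mp ?_)
        rw [map_sub, map_one, map_sum, sub_eq_zero]
        simp only [hε]
        exact (Finset.univ_sum_single (1 : Fin N → K)).symm
      rw [sub_mul, one_mul, sub_eq_zero, Finset.sum_mul] at this
      exact this
    rw [hsum]
    refine Submodule.sum_mem _ fun i _ =>
      mem_socle_of_smul_eq ((Pi.evalAlgHom K (fun _ => K) i).comp ρ) fun a => ?_
    change a * (ε i * z) = ρ a i • (ε i * z)
    rw [← smul_mul_assoc, ← mul_assoc, ← sub_eq_zero, ← sub_mul]
    refine hz _ ((hker _).mp ?_)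
    rw [map_sub, map_mul, map_smul, hε, sub_eq_zero, mul_comm, ← Pi.single_mul_left, one_mul]
    ext k
    by_cases h : k = i
    · subst h; simp
    · simp [h]

theorem IsBasic.mem_reynoldsIdeal_iff (hb : IsBasic K A) (z : A) :
    z ∈ reynoldsIdeal K A ↔ z ∈ Subalgebra.center K A ∧ ∀ j ∈ Ring.jacobson A, j * z = 0 := by
  rw [← hb.mem_socle_iff]
  rfl

/-- A basic symmetric algebra whose Reynolds ideal is spanned by one element is local. -/
theorem exists_splitIdempotents_one (hs : IsSymmetricAlgebra K A) (hb : IsBasic K A)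
    [Nontrivial A] {r : A} (hr : reynoldsIdeal K A ≤ Submodule.span K {r}) :
    ∃ S : SplitIdempotents K A 1, S.e = 1 := by
  obtain ⟨_, φ, hφ, hnd⟩ := hs
  obtain ⟨N, ρ, hρ, hker⟩ := hb.exists_algHom
  have hN : N ≤ 1 := by
    let Ψ : A →ₗ[K] Module.Dual K A :=
      LinearMap.mk₂ K (fun a b => φ (a * b)) (by simp [add_mul]) (by simp) (by simp [mul_add])
        (by simp)
    have hΨ : Function.Injective Ψ := (injective_iff_map_eq_zero Ψ).mpr fun a ha =>
      hnd a fun b => LinearMap.congr_fun ha b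
    let E : A ≃ₗ[K] Module.Dual K A :=
      LinearEquiv.ofInjectiveOfFinrankEq Ψ hΨ Subspace.dual_finrank_eq.symm
    have hE : ∀ f b, φ (E.symm f * b) = f b := fun f b =>
      LinearMap.congr_fun (E.apply_symm_apply f) b
    -- The symmetrizing form represents each linear form on A/rad A by an element of the Reynolds
    -- ideal, so the number N of simple modules is at most its dimension.
    let G : Module.Dual K (Fin N → K) →ₗ[K] A := E.symm.toLinearMap ∘ₗ ρ.toLinearMap.dualMap
    have hG : Function.Injective G := E.symm.injective.comp
      (LinearMap.dualMap_injective_of_surjective hρ)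
    have hGφ : ∀ f b, φ (G f * b) = f (ρ b) := fun f b => hE _ b
    have hrange : LinearMap.range G ≤ Submodule.span K {r} := by
      refine le_trans ?_ hr
      rintro _ ⟨f, rfl⟩
      rw [hb.mem_reynoldsIdeal_iff, Subalgebra.mem_center_iff]
      constructor
      · intro a
        rw [← sub_eq_zero]
        refine hnd _ fun b => ?_
        rw [sub_mul, map_sub, mul_assoc, hφ, mul_assoc, mul_assoc, hGφ, hGφ, map_mul ρ, map_mul ρ,
          mul_comm, sub_self]
      · intro j hj
        refine hnd _ fun b => ?_
        rw [mul_assoc, hφ, mul_assoc, hGφ, map_mul ρ, (hker j).mpr hj, mul_zero, map_zero]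
    have h1 := Submodule.finrank_mono hrange
    rw [LinearMap.finrank_range_of_inj hG, Subspace.dual_finrank_eq, Module.finrank_fin_fun] at h1
    exact h1.trans ((finrank_span_le_card _).trans (by simp))
  obtain rfl | rfl : N = 0 ∨ N = 1 := by omega
  · exfalso
    obtain ⟨k, hk⟩ := isNilpotent_of_mem_jacobson K ((hker 1).mp (Subsingleton.elim _ _))
    simp at hk
  · refine ⟨⟨1, ⟨⟨fun _ => one_mul _, fun i j hij => absurd (Subsingleton.elim i j) hij⟩, by simp⟩,
      fun j => (Pi.evalAlgHom K (fun _ => K) j).comp ρ, fun i j => ?_, fun a ha => ?_⟩, rfl⟩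
    · simp [Subsingleton.elim i j]
    · exact isNilpotent_of_mem_jacobson K ((hker a).mp (funext ha))

end Basic

/-! ### Hattori–Stallings traces and transfer -/

section Transfer

variable (K : Type u) [Field K] (A : Type v) [Ring A] [Algebra K A]
  (B : Type w) [Ring B] [Algebra K B]

/-- The space spanned by the commutators. -/
def commutatorSpace : Submodule (Subalgebra.center K A) A :=
  Submodule.span _ {x | ∃ a b : A, x = a * b - b * a}

/-- The space `A / [A, A]`. -/
abbrev HHZero : Type v := A ⧸ commutatorSpace K A

/-- The image of the radical in `A / [A, A]`. -/
def radicalClass : Submodule (Subalgebra.center K A) (HHZero K A) :=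
  ((Ring.jacobson A).restrictScalars (Subalgebra.center K A)).map (commutatorSpace K A).mkQ

/-- The action of the centre on the image of the radical in `A / [A, A]`. -/
def centerAction : Subalgebra.center K A →ₐ[K] Module.End K (radicalClass K A) :=
  Algebra.lsmul (A := Subalgebra.center K A) K K (radicalClass K A)

variable {K A B}

theorem mkQ_mul_comm (a b : A) :
    (commutatorSpace K A).mkQ (a * b) = (commutatorSpace K A).mkQ (b * a) := by
  rw [← sub_eq_zero, ← map_sub, Submodule.mkQ_apply, Submodule.Quotient.mk_eq_zero]
  exact Submodule.subset_span ⟨a, b, rfl⟩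

/-- Hattori–Stallings traces do not depend on the order of two factors, nor on dual bases. -/
theorem trace_comm {V V' : Type*} [AddCommGroup V] [Module A V] [AddCommGroup V'] [Module A V']
    {ι ι' : Type*} [Fintype ι] [Fintype ι'] {m : ι → V} {f : ι → V →ₗ[A] A}
    (h : ∀ x, ∑ i, f i x • m i = x) {m' : ι' → V'} {f' : ι' → V' →ₗ[A] A}
    (h' : ∀ x, ∑ i, f' i x • m' i = x) (g : V →ₗ[A] V') (k : V' →ₗ[A] V) :
    ∑ i, (commutatorSpace K A).mkQ (f i (k (g (m i)))) =
      ∑ j, (commutatorSpace K A).mkQ (f' j (g (k (m' j)))) := by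
  have h1 : ∀ i, f i (k (g (m i))) = ∑ j, f' j (g (m i)) * f i (k (m' j)) := fun i => by
    conv_lhs => rw [← h' (g (m i)), map_sum, map_sum]
    simp
  have h2 : ∀ j, f' j (g (k (m' j))) = ∑ i, f i (k (m' j)) * f' j (g (m i)) := fun j => by
    conv_lhs => rw [← h (k (m' j)), map_sum, map_sum]
    simp
  simp only [h1, h2, map_sum]
  rw [Finset.sum_comm]
  exact Finset.sum_congr rfl fun j _ => Finset.sum_congr rfl fun i _ => mkQ_mul_comm _ _

/-- The linear map `B → A / [A, A]` underlying the transfer. -/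
def transferAux {ι : Type*} [Fintype ι] (M : Bimodule K A B) (m : ι → M.carrier)
    (f : ι → M.carrier →ₗ[A] A) : B →ₗ[K] HHZero K A :=
  ∑ i, (commutatorSpace K A).mkQ.restrictScalars K ∘ₗ (f i).restrictScalars K ∘ₗ
    (Algebra.lsmul (A := Bᵐᵒᵖ) K K M.carrier).toLinearMap.flip (m i) ∘ₗ
      (MulOpposite.opLinearEquiv K).toLinearMap

theorem transferAux_apply {ι : Type*} [Fintype ι] (M : Bimodule K A B) (m : ι → M.carrier)
    (f : ι → M.carrier →ₗ[A] A) (b : B) :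
    transferAux M m f b = ∑ i, (commutatorSpace K A).mkQ (f i (MulOpposite.op b • m i)) := by
  simp [transferAux]

/-- The transfer `B / [B, B] → A / [A, A]` given by an `A`-`B`-bimodule with a dual basis as a left
module. -/
def transfer {ι : Type*} [Fintype ι] (M : Bimodule K A B) (m : ι → M.carrier)
    (f : ι → M.carrier →ₗ[A] A) (h : ∀ x, ∑ i, f i x • m i = x) :
    HHZero K B →ₗ[K] HHZero K A :=
  ((commutatorSpace K B).restrictScalars K).liftQ (transferAux M m f) (by
    intro x hx
    rw [Submodule.restrictScalars_mem] at hx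
    rw [LinearMap.mem_ker]
    induction hx using Submodule.closure_induction with
    | zero => simp
    | add x y _ _ hx hy => rw [map_add, hx, hy, add_zero]
    | smul_mem z x hx =>
      obtain ⟨a, b, rfl⟩ := hx
      have hz : z • (a * b - b * a) = (z * a) * b - b * (z * a) := by
        rw [Subalgebra.smul_def, smul_eq_mul, mul_sub, ← mul_assoc, ← mul_assoc, ← mul_assoc,
          Subalgebra.mem_center_iff.mp z.2 b]
      rw [hz, map_sub, sub_eq_zero, transferAux_apply, transferAux_apply]
      have := trace_comm (K := K) h h (Algebra.lsmul K A M.carrier (MulOpposite.op (z * a)))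
        (Algebra.lsmul K A M.carrier (MulOpposite.op b))
      simpa [smul_smul, mul_assoc] using this)
    ∘ₗ (Submodule.Quotient.restrictScalarsEquiv K (commutatorSpace K B)).symm.toLinearMap

theorem transfer_mkQ {ι : Type*} [Fintype ι] (M : Bimodule K A B) (m : ι → M.carrier)
    (f : ι → M.carrier →ₗ[A] A) (h : ∀ x, ∑ i, f i x • m i = x) (b : B) :
    transfer M m f h ((commutatorSpace K B).mkQ b) =
      ∑ i, (commutatorSpace K A).mkQ (f i (MulOpposite.op b • m i)) := by
  rw [← transferAux_apply]
  rfl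

/-- Applying a character of `A` to the coefficient matrices of right multiplication gives a
multiplicative family of matrices over `K`. A radical element of `B` is nilpotent, so its matrix has
trace zero. -/
theorem transfer_mem_radicalClass {ι : Type*} [Fintype ι] (M : Bimodule K A B)
    (m : ι → M.carrier) (f : ι → M.carrier →ₗ[A] A) (h : ∀ x, ∑ i, f i x • m i = x)
    (hA : IsBasic K A) [FiniteDimensional K B] {x : HHZero K B} (hx : x ∈ radicalClass K B) :
    transfer M m f h x ∈ radicalClass K A := by
  classical
  obtain ⟨b, hb, rfl⟩ := hx
  rw [transfer_mkQ, ← map_sum]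
  refine ⟨_, ?_, rfl⟩
  obtain ⟨N, ρ, -, hker⟩ := hA.exists_algHom
  refine (hker _).mp (funext fun k => ?_)
  let Y : B → Matrix ι ι K := fun b => Matrix.of fun j l => ρ (f l (MulOpposite.op b • m j)) k
  have hY : ∀ b b', Y b * Y b' = Y (b * b') := by
    intro b b'
    ext j l
    rw [Matrix.mul_apply]
    simp only [Y, Matrix.of_apply]
    conv_rhs => rw [MulOpposite.op_mul, mul_smul, ← h (MulOpposite.op b • m j), Finset.smul_sum,
      map_sum, map_sum, Finset.sum_apply]
    refine Finset.sum_congr rfl fun r _ => ?_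
    rw [smul_comm (MulOpposite.op b') _ (m r), (f l).map_smul (f r _), smul_eq_mul, map_mul, Pi.mul_apply]
  have hpow : ∀ r, Y b ^ (r + 1) = Y (b ^ (r + 1)) := by
    intro r
    induction r with
    | zero => simp
    | succ r ih => rw [pow_succ, ih, hY, ← pow_succ]
  have hnil : IsNilpotent (Y b) := by
    obtain ⟨r, hr⟩ := isNilpotent_of_mem_jacobson K (A := B) hb
    refine ⟨r + 1, ?_⟩
    rw [hpow, pow_succ, hr, zero_mul]
    ext j l
    simp [Y]
  have := (Matrix.isNilpotent_trace_of_isNilpotent hnil).eq_zero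
  rw [map_sum, Finset.sum_apply]
  exact this

/-- The sum is the trace of x ↦ b x c, which is nilpotent because left and right multiplications
commute. -/
theorem sum_coord_mul_mul_eq_zero {R : Type*} [Ring R] [Algebra K R] {ι : Type*} [Fintype ι]
    (x : Module.Basis ι K R) {b : R} (hb : IsNilpotent b) (c : R) :
    ∑ k, x.coord k (b * x k * c) = 0 := by
  classical
  let T : R →ₗ[K] R := LinearMap.mulLeft K b ∘ₗ LinearMap.mulRight K c
  have hT : IsNilpotent T := by
    obtain ⟨N, hN⟩ := hb
    refine ⟨N, ?_⟩
    change (LinearMap.mulLeft K b * LinearMap.mulRight K c) ^ N = 0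
    rw [(LinearMap.commute_mulLeft_right b c).mul_pow, LinearMap.pow_mulLeft, hN]
    simp
  have := (LinearMap.isNilpotent_trace_of_isNilpotent hT).eq_zero
  rw [LinearMap.trace_eq_matrix_trace K x, Matrix.trace] at this
  simpa [LinearMap.toMatrix_apply, T, mul_assoc] using this

end Transfer

/-! ### Transfers, the action of the centre, and invariance of Z/R -/

section CentreModReynolds

variable {K : Type u} [Field K] {A : Type v} [Ring A] [Algebra K A]
  {B : Type w} [Ring B] [Algebra K B]

/-- For a bimodule endomorphism `w` of a projective bimodule and a nilpotent element `b`, the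
trace of `x ↦ w (x b)` vanishes. -/
theorem sum_dualBasis_eq_zero {Q : Bimodule K B B} {ι κ : Type*} [Fintype ι] [Fintype κ]
    (x : Module.Basis κ K Bᵐᵒᵖ) (q : ι → Q.carrier) (F : ι → Q.carrier →ₗ[K] B ⊗[K] Bᵐᵒᵖ)
    (hF : ∀ i b x, F i (b • x) = (1 ⊗ₜ b) * F i x) (w : Q.carrier → Q.carrier)
    (hw : ∀ (b : Bᵐᵒᵖ) x, w (b • x) = b • w x) {b : Bᵐᵒᵖ} (hb : IsNilpotent b) :
    ∑ p : ι × κ, contractRight B (x.coord p.2) (F p.1 (w (b • x p.2 • q p.1))) = 0 := by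
  rw [Fintype.sum_prod_type]
  refine Finset.sum_eq_zero fun i _ => ?_
  -- The right action passes through `w` and `F i`; on each pure tensor a ⊗ c what remains is the
  -- trace of x ↦ b x c times a.
  simp only [hw, smul_smul, hF]
  induction F i (w (q i)) with
  | zero => simp
  | tmul a c =>
    simp only [Algebra.TensorProduct.tmul_mul_tmul, one_mul, contractRight_tmul]
    rw [← Finset.sum_smul, sum_coord_mul_mul_eq_zero x hb, zero_smul]
  | add s t hs ht => simp only [mul_add, map_add, Finset.sum_add_distrib, hs, ht, add_zero]

/-- The composite of transfers is the transfer for N ⊗ M, twisted by the bimodule endomorphism given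
by `z`. On B ⊕ Q the diagonal component at B is multiplication by a central element, the one at Q
has zero trace against radical elements, and the off-diagonal ones do not enter the trace. The
clause for `z = 1` makes the transfers mutually inverse on radical classes. -/
theorem exists_center_of_tensorIso {M : Bimodule K A B} {N : Bimodule K B A} {Q : Bimodule K B B}
    [FiniteDimensional K B] [FiniteDimensional K Q.carrier] (hQ : IsProjectiveBimodule Q)
    (hΦ : TensorIsoRegularSum N M Q)
    {ι κ : Type*} [Fintype ι] [Fintype κ] {m : ι → M.carrier} {f : ι → M.carrier →ₗ[A] A}
    (hm : ∀ x, ∑ i, f i x • m i = x) {y : κ → N.carrier} {g : κ → N.carrier →ₗ[B] B}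
    (hy : ∀ x, ∑ i, g i x • y i = x) (z : Subalgebra.center K A) :
    ∃ z' : Subalgebra.center K B, (z = 1 → z' = 1) ∧ ∀ x ∈ radicalClass K B,
      transfer N y g hy (z • transfer M m f hm x) = z' • x := by
  obtain ⟨Φ, hΦ1, hΦ2⟩ := hΦ
  have hz : ∀ a, (z : A) * a = a * z := fun a => (Subalgebra.mem_center_iff.mp z.2 a).symm
  -- the endomorphism of `N ⊗ M` given by `z`
  let θ : BalancedTensor N M →ₗ[K] BalancedTensor N M := balancedLift N M
    (balancedMk N M ∘ₗ Algebra.lsmul K K N.carrier (MulOpposite.op (z : A))) (fun n a x => by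
      simp only [LinearMap.comp_apply, Algebra.lsmul_coe, balancedMk_apply]
      rw [← balancedTmul_smul, smul_smul, smul_smul, ← MulOpposite.op_mul, ← MulOpposite.op_mul,
        hz])
  have hθ : ∀ n x, θ (balancedTmul N M n x) =
      balancedTmul N M (MulOpposite.op (z : A) • n) x := fun n x => balancedLift_tmul N M _ _ n x
  have hleft : ∀ (b : B) (x : BalancedTensor N M),
      Φ (θ (Φ.symm (b • Φ x))) = b • Φ (θ x) := by
    intro b x
    have : Φ.toLinearMap ∘ₗ θ ∘ₗ Φ.symm.toLinearMap ∘ₗ Algebra.lsmul K K _ b ∘ₗ Φ.toLinearMap =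
        Algebra.lsmul K K _ b ∘ₗ Φ.toLinearMap ∘ₗ θ := balanced_ext fun n x => by
      simp only [LinearMap.comp_apply, LinearEquiv.coe_coe, Algebra.lsmul_coe]
      rw [← hΦ1, Φ.symm_apply_apply, hθ, hθ, ← hΦ1, smul_comm]
    exact LinearMap.congr_fun this x
  have hright : ∀ (b : B) (x : BalancedTensor N M),
      Φ (θ (Φ.symm (MulOpposite.op b • Φ x))) = MulOpposite.op b • Φ (θ x) := by
    intro b x
    have : Φ.toLinearMap ∘ₗ θ ∘ₗ Φ.symm.toLinearMap ∘ₗ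
        Algebra.lsmul K K _ (MulOpposite.op b) ∘ₗ Φ.toLinearMap =
        Algebra.lsmul K K _ (MulOpposite.op b) ∘ₗ Φ.toLinearMap ∘ₗ θ :=
      balanced_ext fun n x => by
        simp only [LinearMap.comp_apply, LinearEquiv.coe_coe, Algebra.lsmul_coe]
        rw [← hΦ2, Φ.symm_apply_apply, hθ, hθ, ← hΦ2]
    exact LinearMap.congr_fun this x
  let Ξ : B × Q.carrier →ₗ[B] B × Q.carrier :=
    { toFun := fun y => Φ (θ (Φ.symm y))
      map_add' := by simp
      map_smul' := fun b y => by
        have := hleft b (Φ.symm y)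
        rwa [Φ.apply_symm_apply] at this }
  have hΞ : ∀ y, Ξ y = Φ (θ (Φ.symm y)) := fun y => rfl
  have hΞr : ∀ (b : B) y, Ξ (MulOpposite.op b • y) = MulOpposite.op b • Ξ y := fun b y => by
    have := hright b (Φ.symm y)
    rwa [Φ.apply_symm_apply] at this
  have hone : ∀ b : B, MulOpposite.op b • ((1, 0) : B × Q.carrier) = b • (1, 0) := fun b => by
    ext <;> simp
  -- `Ξ` commutes with both actions of `B`, and these agree on `(1, 0)` up to side; hence `c` is
  -- central.
  set c := (Ξ (1, 0)).1 with hc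
  have hcb : ∀ b, (Ξ (MulOpposite.op b • (1, 0))).1 = c * b := fun b => by rw [hΞr]; rfl
  have hcenter : c ∈ Subalgebra.center K B := Subalgebra.mem_center_iff.mpr fun b => by
    rw [← hcb, hone, map_smul]
    rfl
  refine ⟨⟨c, hcenter⟩, ?_, ?_⟩
  · intro h1
    have hθ1 : θ = LinearMap.id := balanced_ext fun n x => by
      rw [hθ, h1]
      simp
    apply Subtype.ext
    simp [hc, hΞ, hθ1]
  rintro _ ⟨b, hb, rfl⟩
  have hbn : IsNilpotent (MulOpposite.op b) := by
    obtain ⟨k, hk⟩ := isNilpotent_of_mem_jacobson K (A := B) hb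
    exact ⟨k, by rw [← MulOpposite.op_pow, hk, MulOpposite.op_zero]⟩
  -- the dual basis of `B ⊕ Q ≃ N ⊗ M` given by those of `N` and `M`
  let H : κ × ι → BalancedTensor N M →ₗ[K] B := fun p => balancedLift N M
    (LinearMap.mk₂ K (fun n x => g p.1 (MulOpposite.op (f p.2 x) • n)) (by simp)
      (fun c n x => by
        rw [smul_comm]
        exact map_smul ((g p.1).restrictScalars K) c _)
      (by simp [add_smul])
      (fun c n x => by
        have : f p.2 (c • x) = c • f p.2 x := map_smul ((f p.2).restrictScalars K) c x
        rw [this, MulOpposite.op_smul, smul_assoc]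
        exact map_smul ((g p.1).restrictScalars K) c _))
    (fun n a x => by simp [smul_smul])
  have hH : ∀ p n x, H p (balancedTmul N M n x) = g p.1 (MulOpposite.op (f p.2 x) • n) :=
    fun p n x => balancedLift_tmul N M _ _ n x
  let H' : κ × ι → B × Q.carrier →ₗ[B] B := fun p =>
    { toFun := fun y => H p (Φ.symm y)
      map_add' := by simp
      map_smul' := fun b y => by
        have : H p ∘ₗ Φ.symm.toLinearMap ∘ₗ Algebra.lsmul K K _ b ∘ₗ Φ.toLinearMap =
            LinearMap.mulLeft K b ∘ₗ H p := balanced_ext fun n x => by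
          simp only [LinearMap.comp_apply, LinearEquiv.coe_coe, Algebra.lsmul_coe,
            LinearMap.mulLeft_apply]
          rw [← hΦ1, Φ.symm_apply_apply, hH, hH, smul_comm, map_smul, smul_eq_mul]
        simpa using LinearMap.congr_fun this (Φ.symm y) }
  have hH' : ∀ v, ∑ p, H' p v • Φ (balancedTmul N M (y p.1) (m p.2)) = v := by
    intro v
    have : ∑ p : κ × ι, (LinearMap.toSpanSingleton B (B × Q.carrier)
        (Φ (balancedTmul N M (y p.1) (m p.2)))).restrictScalars K ∘ₗ H p = Φ.toLinearMap :=
      balanced_ext fun n x => by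
        simp only [LinearMap.sum_apply, LinearMap.comp_apply, LinearMap.restrictScalars_apply,
          LinearMap.toSpanSingleton_apply, hH, LinearEquiv.coe_coe]
        rw [Fintype.sum_prod_type, Finset.sum_comm]
        simp only [← hΦ1]
        have h1 : ∀ i, ∑ j, Φ (balancedTmul N M (g j (MulOpposite.op (f i x) • n) • y j) (m i)) =
            Φ (balancedMk N M n (f i x • m i)) := fun i => by
          rw [← map_sum, balancedMk_apply, ← balancedTmul_smul]
          conv_rhs => rw [← hy (MulOpposite.op (f i x) • n), ← balancedMk_apply, map_sum,
            LinearMap.sum_apply]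
          rfl
        simp only [h1]
        rw [← map_sum, ← map_sum, hm, balancedMk_apply]
    have := LinearMap.congr_fun this (Φ.symm v)
    rw [LinearEquiv.coe_coe, Φ.apply_symm_apply] at this
    rw [LinearMap.sum_apply] at this
    exact this
  obtain ⟨r, q, F, k, hF, hk, hq⟩ := exists_left_dualBasis Q hQ
  -- A second dual basis, adapted to B ⊕ Q, with `none` indexing the summand B. Comparing traces in
  -- the two dual bases gives the identity.
  let bas : Option (Fin r × Fin (Module.finrank K Bᵐᵒᵖ)) → B × Q.carrier := fun o =>
    o.elim (1, 0) fun p => (0, Module.finBasis K Bᵐᵒᵖ p.2 • q p.1)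
  let fn : Option (Fin r × Fin (Module.finrank K Bᵐᵒᵖ)) → B × Q.carrier →ₗ[B] B := fun o =>
    o.elim (LinearMap.fst B B Q.carrier) fun p => k p ∘ₗ LinearMap.snd B B Q.carrier
  have hfn : ∀ v, ∑ o, fn o v • bas o = v := by
    intro v
    rw [Fintype.sum_option]
    ext
    · simp [fn, bas, Prod.fst_sum]
    · simp [fn, bas, Prod.snd_sum, hq]
  have key := trace_comm (K := K) hH' hfn
    (Ξ ∘ₗ Algebra.lsmul (A := Bᵐᵒᵖ) K B (B × Q.carrier) (MulOpposite.op b)) LinearMap.id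
  rw [Fintype.sum_option] at key
  have hzero : ∑ p : Fin r × Fin (Module.finrank K Bᵐᵒᵖ), k p
      (Ξ (MulOpposite.op b • (0, Module.finBasis K Bᵐᵒᵖ p.2 • q p.1))).2 = 0 := by
    have := sum_dualBasis_eq_zero (Module.finBasis K Bᵐᵒᵖ) q F hF
      (fun x => (Ξ (0, x)).2) (fun b x => by
        have h0 : ((0, b • x) : B × Q.carrier) = MulOpposite.op b.unop • (0, x) := by
          ext <;> simp
        rw [h0, hΞr]
        rfl) hbn
    refine Eq.trans (Finset.sum_congr rfl fun p _ => ?_) this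
    have h0 : MulOpposite.op b • ((0, Module.finBasis K Bᵐᵒᵖ p.2 • q p.1) : B × Q.carrier) =
        (0, MulOpposite.op b • Module.finBasis K Bᵐᵒᵖ p.2 • q p.1) := by
      ext <;> simp
    rw [hk, h0]
  have e1 : transfer N y g hy (z • transfer M m f hm ((commutatorSpace K B).mkQ b)) =
      ∑ p : κ × ι, (commutatorSpace K B).mkQ
        (H' p (Ξ (MulOpposite.op b • Φ (balancedTmul N M (y p.1) (m p.2))))) := by
    rw [transfer_mkQ, Finset.smul_sum, map_sum, Fintype.sum_prod_type, Finset.sum_comm]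
    refine Finset.sum_congr rfl fun i _ => ?_
    rw [← map_smul, transfer_mkQ]
    refine Finset.sum_congr rfl fun j _ => ?_
    congr 1
    change _ = H (j, i) (Φ.symm (Ξ _))
    rw [← hΦ2, hΞ, Φ.symm_apply_apply, Φ.symm_apply_apply, hθ, hH, smul_smul,
      ← MulOpposite.op_mul]
    rfl
  have e2 : (commutatorSpace K B).mkQ (Ξ (MulOpposite.op b • (1, 0))).1 =
      (⟨c, hcenter⟩ : Subalgebra.center K B) • (commutatorSpace K B).mkQ b := by
    rw [hcb, ← map_smul]
    rfl
  rw [e1, ← e2, ← add_zero ((commutatorSpace K B).mkQ _), ← map_zero (commutatorSpace K B).mkQ,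
    ← hzero, map_sum]
  exact key

/-- For algebras stably equivalent of Morita type, the images of the centres in the endomorphism
rings of the radicals modulo commutators are isomorphic. -/
theorem StablyEquivalentOfMoritaType.nonempty_algEquiv (h : StablyEquivalentOfMoritaType K A B)
    [FiniteDimensional K A] [FiniteDimensional K B] (hA : IsBasic K A) (hB : IsBasic K B) :
    Nonempty ((Subalgebra.center K A ⧸ RingHom.ker (centerAction K A)) ≃ₐ[K]
      (Subalgebra.center K B ⧸ RingHom.ker (centerAction K B))) := by
  obtain ⟨M, N, P, Q, _, _, _, _, _, _, hP, hQ, hMN, hNM⟩ := h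
  have := finiteDimensional_of_tensorIso hMN
  have := finiteDimensional_of_tensorIso hNM
  have : Module.Finite A M.carrier := Module.Finite.of_restrictScalars_finite K _ _
  have : Module.Finite B N.carrier := Module.Finite.of_restrictScalars_finite K _ _
  obtain ⟨_, m, f, hm⟩ := exists_dualBasis A M.carrier
  obtain ⟨_, y, g, hy⟩ := exists_dualBasis B N.carrier
  have hB' := exists_center_of_tensorIso hQ hNM hm hy
  have hA' := exists_center_of_tensorIso hP hMN hy hm
  have hB1 : ∀ x ∈ radicalClass K B, transfer N y g hy (transfer M m f hm x) = x := by
    intro x hx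
    obtain ⟨z', h1, h2⟩ := hB' 1
    simpa [h1 rfl] using h2 x hx
  have hA1 : ∀ x ∈ radicalClass K A, transfer M m f hm (transfer N y g hy x) = x := by
    intro x hx
    obtain ⟨z', h1, h2⟩ := hA' 1
    simpa [h1 rfl] using h2 x hx
  let tM : radicalClass K B →ₗ[K] radicalClass K A :=
    (transfer M m f hm).restrict (p := (radicalClass K B).restrictScalars K)
      (q := (radicalClass K A).restrictScalars K)
      fun x hx => transfer_mem_radicalClass M m f hm hA hx
  let tN : radicalClass K A →ₗ[K] radicalClass K B :=
    (transfer N y g hy).restrict (p := (radicalClass K A).restrictScalars K)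
      (q := (radicalClass K B).restrictScalars K)
      fun x hx => transfer_mem_radicalClass N y g hy hB hx
  let E : radicalClass K A ≃ₗ[K] radicalClass K B := LinearEquiv.ofLinearMap tN tM
    (LinearMap.ext fun x => Subtype.ext (hB1 x x.2))
    (LinearMap.ext fun x => Subtype.ext (hA1 x x.2))
  let G : Subalgebra.center K A →ₐ[K] Module.End K (radicalClass K B) :=
    (E.conjAlgEquiv K).toAlgHom.comp (centerAction K A)
  have hG : ∀ z (x : radicalClass K B), (G z x : HHZero K B) =
      transfer N y g hy (z • transfer M m f hm x) := fun z x => rfl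
  have hker : RingHom.ker (centerAction K A) = RingHom.ker G := by
    ext z
    rw [RingHom.mem_ker, RingHom.mem_ker]
    exact (map_eq_zero_iff (E.conjAlgEquiv K) (E.conjAlgEquiv K).injective).symm
  -- After conjugation by the transfers both centres have the same image in the endomorphisms of the
  -- radical class of `B`, so the quotients by the kernels are isomorphic.
  have hrange : G.range = (centerAction K B).range := by
    apply le_antisymm
    · rintro _ ⟨z, rfl⟩
      obtain ⟨z', -, hz'⟩ := hB' z
      exact ⟨z', LinearMap.ext fun x => Subtype.ext (hz' x x.2).symm⟩
    · rintro _ ⟨z', rfl⟩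
      obtain ⟨z, -, hz⟩ := hA' z'
      refine ⟨z, LinearMap.ext fun x => Subtype.ext ?_⟩
      have hx := transfer_mem_radicalClass M m f hm hA x.2
      refine (hG z x).trans ?_
      rw [← hz _ hx, hB1 x x.2]
      exact hB1 _ (Submodule.smul_mem _ z' x.2)
  exact ⟨(Ideal.quotientEquivAlgOfEq K hker).trans ((Ideal.quotientKerEquivRange G).trans
    ((Subalgebra.equivOfEq _ _ hrange).trans
      (Ideal.quotientKerEquivRange (centerAction K B)).symm))⟩

/-- If z J lies in [A,A], the symmetrizing form vanishes on it; as z J is stable under right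
multiplication, non-degeneracy gives z J = 0. The converse is immediate, and for central elements z
J = 0 means membership in the Reynolds ideal. -/
theorem mem_ker_centerAction_iff (hs : IsSymmetricAlgebra K A) (hb : IsBasic K A)
    (z : Subalgebra.center K A) :
    z ∈ RingHom.ker (centerAction K A) ↔ (z : A) ∈ reynoldsIdeal K A := by
  obtain ⟨_, φ, hφ, hnd⟩ := hs
  have hz : ∀ a, a * (z : A) = z * a := fun a => Subalgebra.mem_center_iff.mp z.2 a
  have hφ0 : ∀ x ∈ commutatorSpace K A, φ x = 0 := by
    intro x hx
    induction hx using Submodule.closure_induction with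
    | zero => simp
    | add x y _ _ hx hy => rw [map_add, hx, hy, add_zero]
    | smul_mem c x hx =>
      obtain ⟨a, b, rfl⟩ := hx
      rw [Subalgebra.smul_def, smul_eq_mul, mul_sub, map_sub, ← mul_assoc, hφ, ← mul_assoc,
        Subalgebra.mem_center_iff.mp c.2 b, mul_assoc, sub_self]
  rw [hb.mem_reynoldsIdeal_iff, and_iff_right z.2, RingHom.mem_ker]
  constructor
  · intro h j hj
    refine hnd _ fun b => ?_
    have hmem : (commutatorSpace K A).mkQ (j * b) ∈ radicalClass K A :=
      ⟨j * b, Ideal.mul_mem_right _ _ hj, rfl⟩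
    have h0 : z • (commutatorSpace K A).mkQ (j * b) = 0 :=
      congrArg Subtype.val (LinearMap.congr_fun h ⟨_, hmem⟩)
    rw [← map_smul, Submodule.mkQ_apply, Submodule.Quotient.mk_eq_zero] at h0
    rw [hz, mul_assoc]
    exact hφ0 _ h0
  · intro h
    ext ⟨x, hx⟩
    obtain ⟨j, hj, rfl⟩ := hx
    change z • (commutatorSpace K A).mkQ j = 0
    rw [← map_smul, Subalgebra.smul_def, smul_eq_mul, ← hz, h j hj, map_zero]

end CentreModReynolds

/-! ### The centre modulo the Reynolds ideal -/

section Wedge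

variable {K : Type u} [Field K]

theorem HasCentreAndReynolds.nonempty_algEquiv {A : Type v} [Ring A] [Algebra K A] {σ : Type}
    {rels gens : Set (MvPolynomial σ K)} (h : HasCentreAndReynolds K A rels gens)
    (hs : IsSymmetricAlgebra K A) (hb : IsBasic K A) :
    Nonempty ((Subalgebra.center K A ⧸ RingHom.ker (centerAction K A)) ≃ₐ[K]
      (MvPolynomial σ K ⧸ Ideal.span (rels ∪ gens))) := by
  obtain ⟨φ, hφ⟩ := h
  let F : MvPolynomial σ K →ₐ[K] Subalgebra.center K A :=
    φ.toAlgHom.comp (Ideal.Quotient.mkₐ K (Ideal.span rels))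
  let G := (Ideal.Quotient.mkₐ K (RingHom.ker (centerAction K A))).comp F
  have hG : Function.Surjective G := (Ideal.Quotient.mkₐ_surjective K _).comp
    (φ.surjective.comp (Ideal.Quotient.mkₐ_surjective K _))
  have hmem : ∀ p, p ∈ RingHom.ker G ↔ ∃ s ∈ Submodule.span K gens, F p = F s := by
    intro p
    have h1 : p ∈ RingHom.ker G ↔ F p ∈ RingHom.ker (centerAction K A) :=
      Ideal.Quotient.eq_zero_iff_mem
    have h2 : reynoldsIdeal K A = (Submodule.span K gens).map
        ((Subalgebra.center K A).val.toLinearMap ∘ₗ F.toLinearMap) := by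
      rw [hφ, Submodule.map_span]
      rfl
    rw [h1, mem_ker_centerAction_iff hs hb, h2]
    constructor
    · rintro ⟨s, hs, hsp⟩
      exact ⟨s, hs, Subtype.ext hsp.symm⟩
    · rintro ⟨s, hs, hsp⟩
      exact ⟨s, hs, congrArg Subtype.val hsp.symm⟩
  -- Modulo `rels` the linear span of `gens` is already an ideal, since it corresponds to the kernel
  -- of the action.
  have hker : RingHom.ker G = Ideal.span (rels ∪ gens) := by
    apply le_antisymm
    · intro p hp
      obtain ⟨s, hs, hps⟩ := (hmem p).mp hp
      have h1 : p - s ∈ Ideal.span rels := by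
        rw [← Ideal.Quotient.eq]
        exact φ.injective hps
      have h2 : s ∈ Ideal.span gens := Submodule.span_le_restrictScalars K _ gens hs
      rw [Ideal.span_union, ← sub_add_cancel p s]
      exact add_mem (Submodule.mem_sup_left h1) (Submodule.mem_sup_right h2)
    · rw [Ideal.span_le]
      rintro p (hp | hp)
      · refine (hmem p).mpr ⟨0, zero_mem _, ?_⟩
        have : Ideal.Quotient.mk (Ideal.span rels) p = 0 :=
          Ideal.Quotient.eq_zero_iff_mem.mpr (Ideal.subset_span hp)
        change φ (Ideal.Quotient.mk _ p) = F 0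
        rw [this, map_zero, map_zero]
      · exact (hmem p).mpr ⟨p, Submodule.subset_span hp, rfl⟩
  exact ⟨((Ideal.quotientEquivAlgOfEq K hker).symm.trans
    (Ideal.quotientKerAlgEquivOfSurjective hG)).symm⟩

theorem finrank_nilradical_pow_eq {R S : Type*} [CommRing R] [Algebra K R] [CommRing S]
    [Algebra K S] (e : R ≃ₐ[K] S) (k : ℕ) :
    Module.finrank K ↥(nilradical R ^ k) = Module.finrank K ↥(nilradical S ^ k) := by
  have h1 : (nilradical R).map e = nilradical S := by
    have : nilradical R = (nilradical S).comap e := by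
      ext x
      rw [Ideal.mem_comap, mem_nilradical, mem_nilradical, IsNilpotent.map_iff e.injective]
    rw [this]
    exact Ideal.map_comap_of_surjective _ e.surjective _
  have h2 : (nilradical S ^ k).restrictScalars K =
      ((nilradical R ^ k).restrictScalars K).map e.toLinearEquiv.toLinearMap := by
    ext x
    rw [← h1, ← Ideal.map_pow, Submodule.restrictScalars_mem,
      Ideal.mem_map_iff_of_surjective _ e.surjective]
    rfl
  exact (LinearEquiv.finrank_map_eq e.toLinearEquiv ((nilradical R ^ k).restrictScalars K)).symm.trans
    (congrArg (fun W : Submodule K S => Module.finrank K W) h2.symm)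

/-- The dimensions of the powers of the nilradical of `K[x₀, x₁, x₂] / (xᵢ ^ pᵢ, xᵢ xⱼ)`, given
by any presentation in which further variables vanish. -/
theorem finrank_nilradical_pow {σ : Type} [DecidableEq σ] (r : Set (MvPolynomial σ K))
    (x : Fin 3 → σ) (p : Fin 3 → ℕ) (hp : ∀ i, 1 ≤ p i)
    (hmul : ∀ i j, i ≠ j → MvPolynomial.X (x i) * MvPolynomial.X (x j) ∈ Ideal.span r)
    (hpow : ∀ i, MvPolynomial.X (x i) ^ p i ∈ Ideal.span r)
    (hvar : ∀ t, (∃ i, t = x i) ∨ MvPolynomial.X t ∈ Ideal.span r)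
    (hx : Function.Injective x)
    (hr : ∀ i, ∀ f ∈ r, (Polynomial.X : Polynomial K) ^ p i ∣
      MvPolynomial.aeval (fun t => if t = x i then Polynomial.X else 0) f)
    (k : ℕ) (hk : 1 ≤ k) :
    Module.finrank K ↥(nilradical (MvPolynomial σ K ⧸ Ideal.span r) ^ k) = ∑ i, (p i - k) := by
  classical
  set R := MvPolynomial σ K ⧸ Ideal.span r
  let mk : MvPolynomial σ K →ₐ[K] R := Ideal.Quotient.mkₐ K (Ideal.span r)
  have hmk : Function.Surjective mk := Ideal.Quotient.mkₐ_surjective K _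
  have hmk0 : ∀ f, mk f = 0 ↔ f ∈ Ideal.span r := fun f => Ideal.Quotient.eq_zero_iff_mem
  let y : Fin 3 → R := fun i => mk (MvPolynomial.X (x i))
  have hyy : ∀ i j, i ≠ j → y i * y j = 0 := fun i j h => by
    rw [← map_mul, hmk0]; exact hmul i j h
  have hyp : ∀ i, y i ^ p i = 0 := fun i => by rw [← map_pow, hmk0]; exact hpow i
  have hev : ∀ i, ∀ f ∈ Ideal.span r, (Polynomial.X : Polynomial K) ^ p i ∣
      MvPolynomial.aeval (fun t => if t = x i then Polynomial.X else 0) f := by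
    intro i f hf
    induction hf using Submodule.span_induction with
    | mem f hf => exact hr i f hf
    | zero => simp
    | add f g _ _ hf hg => rw [map_add]; exact dvd_add hf hg
    | smul c f _ hf => rw [smul_eq_mul, map_mul]; exact hf.mul_left _
  -- linear independence of the powers of the generators
  have hind : LinearIndependent K
      (fun t : (Σ i, Fin (p i - k)) => y t.1 ^ (k + (t.2 : ℕ))) := by
    rw [Fintype.linearIndependent_iff]
    rintro c hc ⟨i, j⟩
    have h1 : ∑ t : (Σ i, Fin (p i - k)),
        c t • (MvPolynomial.X (x t.1) : MvPolynomial σ K) ^ (k + (t.2 : ℕ)) ∈ Ideal.span r := by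
      rw [← hmk0, ← hc, map_sum]
      exact Finset.sum_congr rfl fun t _ => by rw [map_smul, map_pow]
    have h2 := hev i _ h1
    -- Sending `x i` to X and all other variables to 0 isolates the powers of the i-th generator,
    -- which are independent modulo X ^ p i.
    rw [map_sum, Fintype.sum_sigma, Finset.sum_eq_single i] at h2
    rotate_left
    · intro i' _ hi'
      refine Finset.sum_eq_zero fun t _ => ?_
      rw [map_smul, map_pow, MvPolynomial.aeval_X, if_neg (fun h => hi' (hx h)), zero_pow (by omega),
        smul_zero]
    · simp
    have h3 := Polynomial.X_pow_dvd_iff.mp h2 (k + j) (by have := j.2; omega)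
    rw [Polynomial.finsetSum_coeff, Finset.sum_eq_single j] at h3
    · simpa [Polynomial.coeff_X_pow] using h3
    · intro j' _ hj'
      have : (j : ℕ) ≠ j' := fun h => hj' (Fin.ext h.symm)
      simp [Polynomial.coeff_X_pow, this]
    · simp
  have hnontriv : Nontrivial R := by
    refine Ideal.Quotient.nontrivial_iff.mpr fun htop => ?_
    have h1 := hev 0 1 (by rw [htop]; trivial)
    rw [map_one] at h1
    have := Polynomial.X_pow_dvd_iff.mp h1 0 (hp 0)
    simp at this
  have hdecomp : ∀ f, ∃ c : K, mk f - algebraMap K R c ∈ Ideal.span (Set.range y) := by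
    intro f
    induction f using MvPolynomial.induction_on with
    | C a => exact ⟨a, by
        rw [← MvPolynomial.algebraMap_eq, AlgHom.commutes, sub_self]; exact zero_mem _⟩
    | add f g hf hg =>
      obtain ⟨c, hc⟩ := hf
      obtain ⟨d, hd⟩ := hg
      refine ⟨c + d, ?_⟩
      rw [map_add, map_add, add_sub_add_comm]
      exact add_mem hc hd
    | mul_X f t _ =>
      refine ⟨0, ?_⟩
      rw [map_zero, sub_zero, map_mul]
      refine Ideal.mul_mem_left _ _ ?_
      rcases hvar t with ⟨i, rfl⟩ | ht
      · exact Ideal.subset_span ⟨i, rfl⟩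
      · rw [(hmk0 _).mpr ht]; exact zero_mem _
  have hnil : nilradical R = Ideal.span (Set.range y) := by
    have hle : Ideal.span (Set.range y) ≤ nilradical R := by
      rw [Ideal.span_le]
      rintro _ ⟨i, rfl⟩
      exact mem_nilradical.mpr ⟨p i, hyp i⟩
    refine le_antisymm (fun a ha => ?_) hle
    obtain ⟨f, rfl⟩ := hmk a
    obtain ⟨c, hc⟩ := hdecomp f
    have h1 : algebraMap K R c ∈ nilradical R := by
      have := sub_mem ha (hle hc)
      rwa [sub_sub_cancel] at this
    have h2 : c = 0 :=
      ((IsNilpotent.map_iff (algebraMap K R).injective).mp (mem_nilradical.mp h1)).eq_zero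
    rwa [h2, map_zero, sub_zero] at hc
  -- Mixed products vanish, so only pure powers survive.
  have hspan : ∀ k, nilradical R ^ (k + 1) = Ideal.span (Set.range fun i => y i ^ (k + 1)) := by
    intro k
    induction k with
    | zero => simp [hnil]
    | succ k ih =>
      rw [pow_succ, ih, hnil, Ideal.span_mul_span']
      apply le_antisymm
      · rw [Ideal.span_le]
        rintro _ ⟨_, ⟨i, rfl⟩, _, ⟨j, rfl⟩, rfl⟩
        by_cases hij : i = j
        · subst hij
          exact Ideal.subset_span ⟨i, pow_succ _ _⟩
        · change y i ^ (k + 1) * y j ∈ _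
          rw [pow_succ, mul_assoc, hyy i j hij, mul_zero]
          exact zero_mem _
      · rw [Ideal.span_le]
        rintro _ ⟨i, rfl⟩
        exact Ideal.subset_span ⟨_, ⟨i, rfl⟩, _, ⟨i, rfl⟩, (pow_succ _ _).symm⟩
  obtain ⟨k, rfl⟩ : ∃ k', k = k' + 1 := ⟨k - 1, by omega⟩
  set S := Submodule.span K (Set.range
    fun t : (Σ i, Fin (p i - (k + 1))) => y t.1 ^ (k + 1 + (t.2 : ℕ))) with hS
  have hyS : ∀ i j, y i ^ (k + 1 + j) ∈ S := by
    intro i j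
    by_cases hj : k + 1 + j < p i
    · exact Submodule.subset_span ⟨⟨i, ⟨j, by omega⟩⟩, rfl⟩
    · rw [← Nat.sub_add_cancel (not_lt.mp hj), pow_add, hyp, mul_zero]
      exact zero_mem _
  have hmulS : ∀ f i j, mk f * y i ^ (k + 1 + j) ∈ S := by
    intro f
    induction f using MvPolynomial.induction_on with
    | C a =>
      intro i j
      rw [← MvPolynomial.algebraMap_eq, AlgHom.commutes, ← Algebra.smul_def]
      exact Submodule.smul_mem _ _ (hyS i j)
    | add f g hf hg =>
      intro i j
      rw [map_add, add_mul]
      exact add_mem (hf i j) (hg i j)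
    | mul_X f t hf =>
      intro i j
      rw [map_mul, mul_assoc]
      rcases hvar t with ⟨i', rfl⟩ | ht
      · by_cases hi : i' = i
        · subst hi
          change mk f * (y i' * y i' ^ (k + 1 + j)) ∈ S
          rw [← pow_succ']
          exact hf i' (j + 1)
        · change mk f * (y i' * y i ^ (k + 1 + j)) ∈ S
          rw [show k + 1 + j = (k + j) + 1 by omega, pow_succ', ← mul_assoc (y i'), hyy i' i hi,
            zero_mul, mul_zero]
          exact zero_mem _
      · rw [(hmk0 _).mpr ht, zero_mul, mul_zero]; exact zero_mem _
  have heq : (nilradical R ^ (k + 1)).restrictScalars K = S := by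
    apply le_antisymm
    · intro a ha
      rw [Submodule.restrictScalars_mem, hspan] at ha
      induction ha using Submodule.closure_induction with
      | zero => exact zero_mem _
      | add a b _ _ ha hb => exact add_mem ha hb
      | smul_mem c a ha =>
        obtain ⟨i, rfl⟩ := ha
        obtain ⟨f, rfl⟩ := hmk c
        exact hmulS f i 0
    · rw [hS, Submodule.span_le]
      rintro _ ⟨t, rfl⟩
      change y t.1 ^ (k + 1 + (t.2 : ℕ)) ∈ nilradical R ^ (k + 1)
      rw [hspan, pow_add]
      exact Ideal.mul_mem_right _ _ (Ideal.subset_span ⟨t.1, rfl⟩)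
  have : Module.finrank K S = ∑ i, (p i - (k + 1)) := by
    rw [hS, finrank_span_eq_card hind, Fintype.card_sigma]
    simp
  rw [← this]
  exact congrArg (fun W : Submodule K R => Module.finrank K W) heq

/-- The second differences of the truncated sums count how often each positive value occurs, so `p`
and `q` agree as multisets. Positivity supplies the case k = 0, which exceeds the case k = 1 by 3 on
both sides. -/
theorem prod_eq_of_sum_tsub_eq {p q : Fin 3 → ℕ} (hp : ∀ i, 1 ≤ p i) (hq : ∀ i, 1 ≤ q i)
    (h : ∀ k, 1 ≤ k → ∑ i, (p i - k) = ∑ i, (q i - k)) : ∏ i, p i = ∏ i, q i := by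
  have h0 : ∀ k, ∑ i, (p i - k) = ∑ i, (q i - k) := by
    intro k
    rcases Nat.eq_zero_or_pos k with rfl | hk
    · have h1 := h 1 le_rfl
      have := hp 0; have := hp 1; have := hp 2
      have := hq 0; have := hq 1; have := hq 2
      simp only [Fin.sum_univ_three] at h1 ⊢
      omega
    · exact h k hk
  have hcount : ∀ (f : Fin 3 → ℕ) (a : ℕ), Multiset.count (a + 1) (Multiset.map f Finset.univ.val) +
      2 * ∑ i, (f i - (a + 1)) = ∑ i, (f i - a) + ∑ i, (f i - (a + 2)) := by
    intro f a
    have : ∀ i, (if a + 1 = f i then 1 else 0) + 2 * (f i - (a + 1)) =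
        (f i - a) + (f i - (a + 2)) := fun i => by split_ifs <;> omega
    rw [Multiset.count_map, Finset.mul_sum, ← Finset.sum_add_distrib]
    simp only [← this]
    rw [Finset.sum_add_distrib]
    congr 1
    rw [← Finset.card_filter]
    rfl
  have hm : Multiset.map p Finset.univ.val = Multiset.map q Finset.univ.val := by
    ext a
    cases a with
    | zero =>
      rw [Multiset.count_eq_zero_of_notMem, Multiset.count_eq_zero_of_notMem]
      · intro h
        obtain ⟨i, -, hi⟩ := Multiset.mem_map.mp h
        have := hq i
        omega
      · intro h
        obtain ⟨i, -, hi⟩ := Multiset.mem_map.mp h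
        have := hp i
        omega
    | succ a =>
      have h1 := hcount p a
      have h2 := hcount q a
      rw [h0, h0, h0] at h1
      omega
  exact congrArg Multiset.prod hm

end Wedge

/-! ### The invariants of the three classes -/

section Invariants

variable {K : Type u} [Field K] {A : Type v} [Ring A] [Algebra K A]

/-- The centre of `A` modulo the Reynolds ideal has the Loewy structure of
`K[x₀, x₁, x₂] / (xᵢ ^ pᵢ, xᵢ xⱼ)`. -/
def HasLoewyParameters (K : Type u) [Field K] (A : Type v) [Ring A] [Algebra K A]
    (p : Fin 3 → ℕ) : Prop :=
  ∀ k, 1 ≤ k → Module.finrank K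
    ↥(nilradical (Subalgebra.center K A ⧸ RingHom.ker (centerAction K A)) ^ k) = ∑ i, (p i - k)

theorem HasCentreAndReynolds.hasLoewyParameters {σ : Type} [DecidableEq σ]
    {rels gens : Set (MvPolynomial σ K)}
    (h : HasCentreAndReynolds K A rels gens) (hs : IsSymmetricAlgebra K A) (hb : IsBasic K A)
    (x : Fin 3 → σ) (p : Fin 3 → ℕ) (hp : ∀ i, 1 ≤ p i)
    (h01 : MvPolynomial.X (x 0) * MvPolynomial.X (x 1) ∈ Ideal.span (rels ∪ gens))
    (h02 : MvPolynomial.X (x 0) * MvPolynomial.X (x 2) ∈ Ideal.span (rels ∪ gens))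
    (h12 : MvPolynomial.X (x 1) * MvPolynomial.X (x 2) ∈ Ideal.span (rels ∪ gens))
    (hpow : ∀ i, MvPolynomial.X (x i) ^ p i ∈ Ideal.span (rels ∪ gens))
    (hvar : ∀ t, (∃ i, t = x i) ∨ MvPolynomial.X t ∈ Ideal.span (rels ∪ gens))
    (hx : Function.Injective x)
    (hr : ∀ i, ∀ f ∈ rels ∪ gens, (Polynomial.X : Polynomial K) ^ p i ∣
      MvPolynomial.aeval (fun t => if t = x i then Polynomial.X else 0) f) :
    HasLoewyParameters K A p := by
  intro k hk
  obtain ⟨e⟩ := h.nonempty_algEquiv hs hb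
  rw [finrank_nilradical_pow_eq e]
  refine finrank_nilradical_pow _ x p hp (fun i j hij => ?_) hpow hvar hx hr k hk
  fin_cases i <;> fin_cases j <;>
    first
      | exact absurd rfl hij
      | assumption
      | rw [mul_comm]; assumption

open MvPolynomial in
-- Modulo the Reynolds ideal the Sᵢ vanish, and the relations expressing the top powers of A, B, C
-- through them lower each nilpotency exponent by one.
theorem IsTypeThree.hasLoewyParameters {a b c : ℕ} (h : IsTypeThree K A a b c) (ha : 1 ≤ a)
    (hb : 1 ≤ b) (hc : 1 ≤ c) : HasLoewyParameters K A ![a, b, c] := by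
  have hsub : ∀ f ∈ threeRels K a b c ∪ {X 3, X 4, X 5},
      f ∈ Ideal.span (threeRels K a b c ∪ {X 3, X 4, X 5}) := fun f hf => Ideal.subset_span hf
  revert hsub
  generalize hI : Ideal.span (threeRels K a b c ∪ {X 3, X 4, X 5}) = I
  intro hsub
  simp only [threeRels, Set.mem_union, Set.mem_insert_iff, Set.mem_singleton_iff, or_imp,
    forall_and, forall_eq] at hsub
  obtain ⟨⟨-, -, -, hA, hB, hC, -, -, -, -, -, -, -, -, -, -, -, -, -, -, -, hAB, hAC, hBC⟩,
    h3, h4, h5⟩ := hsub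
  have ha0 : a ≠ 0 := by omega
  have hb0 : b ≠ 0 := by omega
  have hc0 : c ≠ 0 := by omega
  refine h.centre.hasLoewyParameters h.symmetric h.basic ![0, 1, 2] _ ?_ ?_ ?_ ?_ ?_ ?_ ?_ ?_ <;>
    try rw [hI]
  · intro i; fin_cases i <;> assumption
  · exact hAB
  · exact hAC
  · exact hBC
  · intro i
    fin_cases i
    · change X 0 ^ a ∈ I
      convert add_mem (add_mem hA h4) h5 using 1
      ring
    · change X 1 ^ b ∈ I
      convert add_mem (add_mem hB h5) h3 using 1
      ring
    · change X 2 ^ c ∈ I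
      convert add_mem (add_mem hC h3) h4 using 1
      ring
  · intro t
    fin_cases t
    · exact Or.inl ⟨0, rfl⟩
    · exact Or.inl ⟨1, rfl⟩
    · exact Or.inl ⟨2, rfl⟩
    · exact Or.inr h3
    · exact Or.inr h4
    · exact Or.inr h5
  · decide
  · intro i
    fin_cases i <;> simp [threeRels, ha0, hb0, hc0, pow_succ]

open MvPolynomial in
-- The quotient does not see the characteristic: in characteristic 2 killing u^k also kills v^s, and
-- w disappears; otherwise both powers are killed directly. The parameter 2 comes from t.
theorem IsTypeTwo.hasLoewyParameters {k s : ℕ} (h : IsTypeTwo K A k s) (hk : 1 ≤ k)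
    (hs : 1 ≤ s) : HasLoewyParameters K A ![k, s, 2] := by
  have hk0 : k ≠ 0 := by omega
  have hs0 : s ≠ 0 := by omega
  by_cases h2 : CharP K 2
  · have hsub : ∀ f ∈ twoRelsCharTwo K k s ∪ {X 0 ^ k, X 2},
        f ∈ Ideal.span (twoRelsCharTwo K k s ∪ {X 0 ^ k, X 2}) := fun f hf => Ideal.subset_span hf
    revert hsub
    generalize hI : Ideal.span (twoRelsCharTwo K k s ∪ {X 0 ^ k, X 2}) = I
    intro hsub
    simp only [twoRelsCharTwo, Set.mem_union, Set.mem_insert_iff, Set.mem_singleton_iff, or_imp,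
      forall_and, forall_eq] at hsub
    obtain ⟨⟨huv, -, ht, huv', -, -, -, hut, hvt⟩, hu, hw⟩ := hsub
    refine (h.centre_of_char_two h2).hasLoewyParameters h.symmetric h.basic ![0, 1, 3] _
      ?_ ?_ ?_ ?_ ?_ ?_ ?_ ?_ <;> try rw [hI]
    · intro i; fin_cases i <;> first | assumption | exact one_le_two
    · exact huv'
    · exact hut
    · exact hvt
    · intro i
      fin_cases i
      · exact hu
      · convert sub_mem hu huv using 1; simp
      · exact ht
    · intro t
      fin_cases t
      · exact Or.inl ⟨0, rfl⟩
      · exact Or.inl ⟨1, rfl⟩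
      · exact Or.inr hw
      · exact Or.inl ⟨2, rfl⟩
    · decide
    · intro i
      fin_cases i <;> simp [twoRelsCharTwo, hk0, hs0]
  · have hsub : ∀ f ∈ twoRels K k s ∪ {X 0 ^ k, X 1 ^ s},
        f ∈ Ideal.span (twoRels K k s ∪ {X 0 ^ k, X 1 ^ s}) := fun f hf => Ideal.subset_span hf
    revert hsub
    generalize hI : Ideal.span (twoRels K k s ∪ {X 0 ^ k, X 1 ^ s}) = I
    intro hsub
    simp only [twoRels, Set.mem_union, Set.mem_insert_iff, Set.mem_singleton_iff, or_imp,
      forall_and, forall_eq] at hsub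
    obtain ⟨⟨-, -, ht, huv, hut, hvt⟩, hu, hv⟩ := hsub
    refine (h.centre_of_char_ne_two h2).hasLoewyParameters h.symmetric h.basic ![0, 1, 2] _
      ?_ ?_ ?_ ?_ ?_ ?_ ?_ ?_ <;> try rw [hI]
    · intro i; fin_cases i <;> first | assumption | exact one_le_two
    · exact huv
    · exact hut
    · exact hvt
    · intro i
      fin_cases i <;> assumption
    · intro t
      exact Or.inl ⟨t, by fin_cases t <;> rfl⟩
    · decide
    · intro i
      fin_cases i <;> simp [twoRels, hk0, hs0, pow_succ]

open MvPolynomial in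
-- In characteristic 2 the Reynolds ideal removes the variable T; otherwise it lowers the exponent
-- of U from l + 1 to l. Either way V and W contribute 2 and 2.
theorem IsTypeOne.hasLoewyParameters {l : ℕ} (h : IsTypeOne K A l) (hl : 2 ≤ l) :
    HasLoewyParameters K A ![l, 2, 2] := by
  have hl0 : l ≠ 0 := by omega
  have hl1 : 1 ≤ l := by omega
  by_cases h2 : CharP K 2
  · have hsub : ∀ f ∈ oneRelsCharTwo K l ∪ {X 1},
        f ∈ Ideal.span (oneRelsCharTwo K l ∪ {X 1}) := fun f hf => Ideal.subset_span hf
    revert hsub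
    generalize hI : Ideal.span (oneRelsCharTwo K l ∪ {X 1}) = I
    intro hsub
    simp only [oneRelsCharTwo, Set.mem_union, Set.mem_insert_iff, Set.mem_singleton_iff, or_imp,
      forall_and, forall_eq] at hsub
    obtain ⟨⟨hU, -, hV, hW, -, hUV, hUW, -, -, hVW⟩, hT⟩ := hsub
    refine (h.centre_of_char_two h2).hasLoewyParameters h.symmetric h.basic ![0, 2, 3] _
      ?_ ?_ ?_ ?_ ?_ ?_ ?_ ?_ <;> try rw [hI]
    · intro i; fin_cases i <;> first | assumption | exact one_le_two
    · exact hUV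
    · exact hUW
    · exact hVW
    · intro i
      fin_cases i <;> assumption
    · intro t
      fin_cases t
      · exact Or.inl ⟨0, rfl⟩
      · exact Or.inr hT
      · exact Or.inl ⟨1, rfl⟩
      · exact Or.inl ⟨2, rfl⟩
    · decide
    · intro i
      fin_cases i <;> simp [oneRelsCharTwo, hl0]
  · have hsub : ∀ f ∈ oneRels K l ∪ {X 0 ^ l},
        f ∈ Ideal.span (oneRels K l ∪ {X 0 ^ l}) := fun f hf => Ideal.subset_span hf
    revert hsub
    generalize hI : Ideal.span (oneRels K l ∪ {X 0 ^ l}) = I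
    intro hsub
    simp only [oneRels, Set.mem_union, Set.mem_insert_iff, Set.mem_singleton_iff, or_imp,
      forall_and, forall_eq] at hsub
    obtain ⟨⟨-, hV, hW, hUV, hUW, hVW⟩, hU⟩ := hsub
    refine (h.centre_of_char_ne_two h2).hasLoewyParameters h.symmetric h.basic ![0, 1, 2] _
      ?_ ?_ ?_ ?_ ?_ ?_ ?_ ?_ <;> try rw [hI]
    · intro i; fin_cases i <;> first | assumption | exact one_le_two
    · exact hUV
    · exact hUW
    · exact hVW
    · intro i
      fin_cases i <;> assumption
    · intro t
      exact Or.inl ⟨t, by fin_cases t <;> rfl⟩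
    · decide
    · intro i
      fin_cases i <;> simp [oneRels, hl0, pow_succ]

theorem StablyEquivalentOfMoritaType.prod_eq {B : Type w} [Ring B] [Algebra K B]
    (h : StablyEquivalentOfMoritaType K A B) (hA : IsSymmetricAlgebra K A) (hA' : IsBasic K A)
    (hB : IsSymmetricAlgebra K B) (hB' : IsBasic K B) {p q : Fin 3 → ℕ}
    (hp : HasLoewyParameters K A p) (hq : HasLoewyParameters K B q) (hp1 : ∀ i, 1 ≤ p i)
    (hq1 : ∀ i, 1 ≤ q i) : ∏ i, p i = ∏ i, q i := by
  have := hA.1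
  have := hB.1
  obtain ⟨e⟩ := h.nonempty_algEquiv hA' hB'
  refine prod_eq_of_sum_tsub_eq hp1 hq1 fun k hk => ?_
  rw [← hp k hk, ← hq k hk, finrank_nilradical_pow_eq e]

theorem HasCartanMatrix.exists_splitIdempotents [FiniteDimensional K A] (hb : IsBasic K A) {n : ℕ}
    {C : Matrix (Fin n) (Fin n) ℕ} (h : HasCartanMatrix K A C) :
    ∃ S : SplitIdempotents K A n, S.cartan = C.map Nat.cast := by
  obtain ⟨e, he, hprim, hC⟩ := h
  obtain ⟨S, rfl⟩ := hb.exists_splitIdempotents e he hprim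
  refine ⟨S, ?_⟩
  ext i j
  simp [SplitIdempotents.cartan, hC]

theorem IsTypeThree.exists_splitIdempotents {a b c : ℕ} (h : IsTypeThree K A a b c) :
    ∃ S : SplitIdempotents K A 3, S.cartan.det = 4 * (a * b * c) := by
  have := h.symmetric.1
  obtain ⟨S, hS⟩ := h.cartan.exists_splitIdempotents h.basic
  refine ⟨S, ?_⟩
  rw [hS, Matrix.det_fin_three]
  simp
  ring

theorem IsTypeTwo.exists_splitIdempotents {k s : ℕ} (h : IsTypeTwo K A k s) :
    ∃ S : SplitIdempotents K A 2, S.cartan.det = 4 * (k * s) := by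
  have := h.symmetric.1
  obtain ⟨S, hS⟩ := h.cartan.exists_splitIdempotents h.basic
  refine ⟨S, ?_⟩
  rw [hS, Matrix.det_fin_two]
  simp
  ring

/-- The Reynolds ideal is spanned by one element, so the algebra is local and its Cartan matrix is
the single entry dim A. -/
theorem IsTypeOne.exists_splitIdempotents {l : ℕ} (h : IsTypeOne K A l) :
    ∃ S : SplitIdempotents K A 1, S.cartan.det = 4 * l := by
  have := h.symmetric.1
  have := h.indecomposable.1
  obtain ⟨r, hr⟩ : ∃ r : A, reynoldsIdeal K A ≤ Submodule.span K {r} := by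
    by_cases h2 : CharP K 2
    · obtain ⟨φ, hφ⟩ := h.centre_of_char_two h2
      exact ⟨_, by rw [hφ, Set.image_singleton]⟩
    · obtain ⟨φ, hφ⟩ := h.centre_of_char_ne_two h2
      exact ⟨_, by rw [hφ, Set.image_singleton]⟩
  obtain ⟨S, hS⟩ := exists_splitIdempotents_one h.symmetric h.basic hr
  refine ⟨S, ?_⟩
  have h1 : peirce K (S.e 0) (S.e 0) = ⊤ :=
    eq_top_iff.mpr fun x _ => mem_peirce (by simp [hS]) (by simp [hS])
  rw [Matrix.det_fin_one]
  change (Module.finrank K (peirce K (S.e 0) (S.e 0)) : ℤ) = _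
  rw [h1, finrank_top, h.finrank_eq]
  push_cast
  rfl

end Invariants
end StableMorita

/-! ### Comparison of the two invariants -/

theorem proposition6p6 (K : Type u) [Field K] :
    (∀ (A : Type v) [Ring A] [Algebra K A] (B : Type w) [Ring B] [Algebra K B] (a b c k s : ℕ),
      1 ≤ a → 1 ≤ b → 1 ≤ c → 1 ≤ k → 1 ≤ s →
      StableMorita.IsTypeThree K A a b c → StableMorita.IsTypeTwo K B k s →
      ¬ StableMorita.StablyEquivalentOfMoritaType K A B) ∧
    (∀ (A : Type v) [Ring A] [Algebra K A] (B : Type w) [Ring B] [Algebra K B] (k s l : ℕ),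
      1 ≤ k → 1 ≤ s → 2 ≤ l →
      StableMorita.IsTypeTwo K A k s → StableMorita.IsTypeOne K B l →
      ¬ StableMorita.StablyEquivalentOfMoritaType K A B) ∧
    (∀ (A : Type v) [Ring A] [Algebra K A] (B : Type w) [Ring B] [Algebra K B] (a b c l : ℕ),
      1 ≤ a → 1 ≤ b → 1 ≤ c → 2 ≤ l →
      StableMorita.IsTypeThree K A a b c → StableMorita.IsTypeOne K B l →
      ¬ StableMorita.StablyEquivalentOfMoritaType K A B) := by
  refine ⟨?_, ?_, ?_⟩
  · intro A _ _ B _ _ a b c k s ha hb hc hk hs hA hB h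
    have := hA.symmetric.1
    have := hB.symmetric.1
    have hprod := h.prod_eq hA.symmetric hA.basic hB.symmetric hB.basic
      (hA.hasLoewyParameters ha hb hc) (hB.hasLoewyParameters hk hs)
      (fun i => by fin_cases i <;> assumption)
      (fun i => by fin_cases i <;> first | assumption | exact one_le_two)
    simp only [Fin.prod_univ_three] at hprod
    -- The determinants are therefore 8ks and 4ks.
    change a * b * c = k * s * 2 at hprod
    obtain ⟨S, hS⟩ := hA.exists_splitIdempotents
    obtain ⟨S', hS'⟩ := hB.exists_splitIdempotents
    have hpos : 0 < k * s := by positivity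
    have h1 : S.cartan.det = ((4 * (k * s * 2) : ℕ) : ℤ) := by rw [hS, ← hprod]; push_cast; ring
    have h2 : S'.cartan.det = ((4 * (k * s) : ℕ) : ℤ) := by rw [hS']; push_cast; ring
    have hdvd := h.det_cartan_dvd S S' (by rw [h1]; positivity)
    rw [h1, h2, Int.natCast_dvd_natCast] at hdvd
    have := Nat.le_of_dvd (by omega) hdvd
    omega
  · intro A _ _ B _ _ k s l hk hs hl hA hB h
    have := hA.symmetric.1
    have := hB.symmetric.1
    have hl1 : 1 ≤ l := by omega
    have hprod := h.prod_eq hA.symmetric hA.basic hB.symmetric hB.basic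
      (hA.hasLoewyParameters hk hs) (hB.hasLoewyParameters hl)
      (fun i => by fin_cases i <;> first | assumption | exact one_le_two)
      (fun i => by fin_cases i <;> first | assumption | exact one_le_two)
    simp only [Fin.prod_univ_three] at hprod
    -- Here ks = 2l, so the determinants are 8l and 4l.
    change k * s * 2 = l * 2 * 2 at hprod
    obtain ⟨S, hS⟩ := hA.exists_splitIdempotents
    obtain ⟨S', hS'⟩ := hB.exists_splitIdempotents
    have h1 : S.cartan.det = ((4 * (k * s) : ℕ) : ℤ) := by rw [hS]; push_cast; ring
    have h2 : S'.cartan.det = ((4 * l : ℕ) : ℤ) := by rw [hS']; push_cast; ring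
    have hdvd := h.det_cartan_dvd S S' (by rw [h1]; positivity)
    rw [h1, h2, Int.natCast_dvd_natCast] at hdvd
    have := Nat.le_of_dvd (by omega) hdvd
    omega
  · intro A _ _ B _ _ a b c l ha hb hc hl hA hB h
    have := hA.symmetric.1
    have := hB.symmetric.1
    have hl1 : 1 ≤ l := by omega
    have hprod := h.prod_eq hA.symmetric hA.basic hB.symmetric hB.basic
      (hA.hasLoewyParameters ha hb hc) (hB.hasLoewyParameters hl)
      (fun i => by fin_cases i <;> assumption)
      (fun i => by fin_cases i <;> first | assumption | exact one_le_two)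
    simp only [Fin.prod_univ_three] at hprod
    -- The determinants are therefore 16l and 4l.
    change a * b * c = l * 2 * 2 at hprod
    obtain ⟨S, hS⟩ := hA.exists_splitIdempotents
    obtain ⟨S', hS'⟩ := hB.exists_splitIdempotents
    have h1 : S.cartan.det = ((4 * (a * b * c) : ℕ) : ℤ) := by rw [hS]; push_cast; ring
    have h2 : S'.cartan.det = ((4 * l : ℕ) : ℤ) := by rw [hS']; push_cast; ring
    have hdvd := h.det_cartan_dvd S S' (by rw [h1]; positivity)
    rw [h1, h2, Int.natCast_dvd_natCast] at hdvd
    have := Nat.le_of_dvd (by omega) hdvd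
    omega
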